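/- **Setting.** Consider a stochastic bandit with arms $1,\dots,K$ ($K\ge 1$) and horizon $T\ge 1$. An environment $\mathcal F$ assigns to each arm $k$ and time $t\in\{1,\dots,T\}$ a probability distribution $f_t^k$ on $\mathbb R$. At time $t$ a policy $\rho$ selects an arm $\varphi_t$ (possibly at random) on the basis of the past observations $(\varphi_s,X_s)_{s<t}$; given these and $\varphi_t=k$, the reward $X_t$ is drawn from $f_t^k$. Let $\mu_t^k$ be the mean of $f_t^k$, $\mu_t^*=\max_k\mu_t^k$, and $$R_T^\rho=\sum_{t=1}^T\mu_t^*-\mathbb E^\rho\Big[\sum_{t=1}^T X_t\Big].$$ For $V>0$ let $\mathcal E(V,T,K)$ be the set of environments such that $\int x^2\,f_t^k(dx)\le 1$ for all $k$ and $t$ (heavy-tailed rewards) and $\sum_{t=1}^{T-1}\max_k|\mu_{t+1}^k-\mu_t^k|\le V$. **Policy.** Let $a>1$, $\zeta>0$, $\ln_+(x)=\max(\ln x,1)$, $\psi(x)=(1+1/x)\ln(1+x)-1$, $h(m)=a^{\lfloor\log_a m\rfloor+1}$, $\mathrm{sat}(x,B)=\mathrm{sign}(x)\min\{|x|,B\}$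 and, for $\tau\ge 1$, $$B_m=\sqrt{\frac{h(m)}{\ln_+\big(\tau/(K h(m))\big)}},\qquad c_m=\sqrt{\frac{\ln_+\big(\tau/(Km)\big)}{m}}.$$ Resetting Robust MOSS (R-RMOSS) with period $\tau$ splits time into the epochs $\{1,\dots,\tau\},\{\tau+1,\dots,2\tau\},\dots$ and in each epoch uses only the data of that epoch. At time $t$ let $n_k$ be the number of earlier selections of arm $k$ in the current epoch. If some arms have $n_k=0$, one of them is selected. Otherwise an arm is selected that maximizes $$\frac1{n_k}\sum_{s}\mathrm{sat}(X_s,B_{n_k})+(1+\zeta)\,c_{n_k},$$ where the sum is over the earlier times $s$ in the current epoch with $\varphi_s=k$. The order of the initial selections and the tie-breaking are arbitrary. **Theorem.** Let $a>1$ and $\zeta>0$ satisfy $\psi(2\zeta/a)\ge 2a/\zeta$. There is a constant $C>0$, depending only on $a$ and $\zeta$, such that for all integers $K,T\ge 1$ and all $V>0$ for which $$\tau=\Big\lceil K^{1/3}(T/V)^{2/3}\Big\rceil\le T,$$ every R-RMOSS policy with parameters $a,\zeta$ and period $\tau$ satisfies $$\sup_{\mathcal F\in\mathcal E(V,T,K)}R_T^{\text{R-RMOSS}}\le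 C\,(KV)^{1/3}\,T^{2/3}.$$ -/

import Mathlib

open MeasureTheory ProbabilityTheory

noncomputable section

namespace NonstationaryBandit

/-! Time slots are numbered `0, 1, 2, …`, and arms are the elements of `Fin K`. -/

/-- The reward distributions: `F t k` is the distribution of the reward of arm `k` at time `t`.
For a horizon `T` only the distributions at times `t < T` matter. -/
abbrev Environment (K : ℕ) := ℕ → Fin K → ProbabilityMeasure ℝ

/-- The selected arms and the observed rewards of the first `t` time slots. -/
abbrev History (K t : ℕ) := Fin t → Fin K × ℝ

/-- A (possibly randomized) policy: for every time `t`, the conditional distribution of the arm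
selected at time `t`, given the past observations. -/
structure Policy (K : ℕ) where
  kernel : (t : ℕ) → Kernel (History K t) (Fin K)
  markov : ∀ t, IsMarkovKernel (kernel t)

/-! ### Environments -/

/-- The mean reward of arm `k` at time `t`. -/
def mean {K : ℕ} (F : Environment K) (t : ℕ) (k : Fin K) : ℝ :=
  ∫ x, x ∂(F t k : Measure ℝ)

/-- The mean reward of the best arm at time `t`. -/
def bestMean {K : ℕ} (F : Environment K) (t : ℕ) : ℝ := ⨆ k, mean F t k

/-- The total variation of the mean rewards over the `T` time slots `0, …, T - 1`. -/
def totalVariation {K : ℕ} (F : Environment K) (T : ℕ) : ℝ :=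
  ∑ t ∈ Finset.range (T - 1), ⨆ k, |mean F (t + 1) k - mean F t k|

/-- Heavy-tailed rewards: `E[X²] ≤ 1` for all arms and all time slots up to the horizon. -/
def HeavyTailed {K : ℕ} (F : Environment K) (T : ℕ) : Prop :=
  ∀ t < T, ∀ k, ∫⁻ x, ENNReal.ofReal (x ^ 2) ∂(F t k : Measure ℝ) ≤ 1

/-- Heavy-tailed environments with total variation at most `V`. -/
def envClass (V : ℝ) (T K : ℕ) : Set (Environment K) :=
  {F | HeavyTailed F T ∧ totalVariation F T ≤ V}

/-! ### Interaction of a policy with an environment -/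

/-- The reward distribution at time `t`, as a kernel from the selected arm. -/
def rewardKernel {K : ℕ} (F : Environment K) (t : ℕ) : Kernel (Fin K) ℝ :=
  Kernel.ofFunOfCountable fun k => (F t k : Measure ℝ)

/-- The law of the history of the first `t` time slots: given the history `h` of the first `t`
slots, the next arm `k` is drawn from `π.kernel t h`, and then, given `h` and `k`, the reward is
drawn from `F t k`. -/
def historyLaw {K : ℕ} (π : Policy K) (F : Environment K) : (t : ℕ) → Measure (History K t)
  | 0 => Measure.dirac Fin.elim0
  | t + 1 =>
    (historyLaw π F t ⊗ₘ
      (π.kernel t ⊗ₖ Kernel.prodMkLeft (History K t) (rewardKernel F t))).map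
        fun p => (Fin.snoc p.1 p.2 : History K (t + 1))

/-- The regret `∑_t μ_t^* - E[S_T]`, where `S_T` is the cumulative reward. -/
def regret {K : ℕ} (π : Policy K) (F : Environment K) (T : ℕ) : ℝ :=
  ∑ t ∈ Finset.range T, bestMean F t - ∫ h, ∑ t : Fin T, (h t).2 ∂(historyLaw π F T)

/-- The worst-case regret over the environments with variation budget `V`. -/
def worstCaseRegret {K : ℕ} (π : Policy K) (V : ℝ) (T : ℕ) : EReal :=
  ⨆ F ∈ envClass V T K, (regret π F T : EReal)

/-! ### Resetting Robust MOSS -/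

/-- `ln₊ x = max (ln x) 1`. -/
def lnPlus (x : ℝ) : ℝ := max (Real.log x) 1

/-- `ψ x = (1 + 1 / x) ln (1 + x) - 1`. -/
def psi (x : ℝ) : ℝ := (1 + 1 / x) * Real.log (1 + x) - 1

/-- `h(m) = a ^ (⌊log_a m⌋ + 1)`. -/
def gridUp (a : ℝ) (m : ℕ) : ℝ := a ^ (⌊Real.logb a m⌋ + 1)

/-- The saturation limit `B_m` of Robust MOSS with `K` arms and horizon `τ`. -/
def satLimit (a : ℝ) (τ K m : ℕ) : ℝ :=
  √(gridUp a m / lnPlus (τ / (K * gridUp a m)))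

/-- `sat(x, B) = sign(x) min {|x|, B}`. -/
def sat (x B : ℝ) : ℝ := Real.sign x * min |x| B

/-- `c_m` of Robust MOSS with `K` arms and horizon `τ`. -/
def confWidth (τ K m : ℕ) : ℝ := √(lnPlus (τ / (K * m)) / m)

/-- The past time slots `s < t` that lie in the same epoch as `t` and in which arm `k` was
selected; the epochs are `{0, …, τ - 1}`, `{τ, …, 2τ - 1}`, …. -/
def pulls {K t : ℕ} (τ : ℕ) (h : History K t) (k : Fin K) : Finset (Fin t) :=
  {s | (s : ℕ) / τ = t / τ ∧ (h s).1 = k}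

/-- The saturated empirical mean of arm `k` in the current epoch. -/
def satMean {K t : ℕ} (a : ℝ) (τ : ℕ) (h : History K t) (k : Fin K) : ℝ :=
  (∑ s ∈ pulls τ h k, sat (h s).2 (satLimit a τ K (pulls τ h k).card)) / (pulls τ h k).card

/-- The upper confidence bound of arm `k`, computed from the data of the current epoch. -/
def ucb {K t : ℕ} (a ζ : ℝ) (τ : ℕ) (h : History K t) (k : Fin K) : ℝ :=
  satMean a τ h k + (1 + ζ) * confWidth τ K (pulls τ h k).card

/-- Robust MOSS, run on the data of the current epoch with horizon `τ`, may select arm `k` after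
the history `h`: as long as some arm has not been selected in the epoch, one of those arms is
selected; afterwards an arm with maximal upper confidence bound. -/
def Admissible {K t : ℕ} (a ζ : ℝ) (τ : ℕ) (h : History K t) (k : Fin K) : Prop :=
  pulls τ h k = ∅ ∨ ((∀ j, pulls τ h j ≠ ∅) ∧ ∀ j, ucb a ζ τ h j ≤ ucb a ζ τ h k)

/-- `π` is a Resetting Robust MOSS policy with parameters `a`, `ζ` that restarts every `τ` time
slots. The order of the initial selections and the tie-breaking are arbitrary. -/
def IsRRMOSS {K : ℕ} (a ζ : ℝ) (τ : ℕ) (π : Policy K) : Prop :=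
  ∀ (t : ℕ) (h : History K t), ∀ᵐ k ∂(π.kernel t h), Admissible a ζ τ h k

/-- The epoch length `⌈K^{1/3} (T / V)^{2/3}⌉`. -/
def resetPeriod (K T : ℕ) (V : ℝ) : ℕ :=
  ⌈(K : ℝ) ^ (1 / 3 : ℝ) * ((T : ℝ) / V) ^ (2 / 3 : ℝ)⌉₊

end NonstationaryBandit

end

open MeasureTheory ProbabilityTheory

noncomputable section

namespace NonstationaryBandit

/-! ### Elementary inequalities -/

/-! Put δ = √(K/τ). In one epoch the expected regret is O(τδ + τv), where v is the variation of the
means in that epoch (`IsPathLaw.integral_sum_epoch_le`). Summed over at most 2T/τ epochs this gives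
O(T√(K/τ) + τV) (`regret_le_of_isRRMOSS`), and the prescribed τ balances the two terms.

Within an epoch, the saturated mean of an arm differs from the arm's true mean at the start of the
epoch by drift (at most v), by saturation bias (at most `confWidth`, because second moments are at
most 1) and by a centred deviation; `excess` is what the last one has beyond ζ times `confWidth`.
Counts are grouped into blocks with a common grid point H. The saturation level is constant on a
block, so Bennett's exponential supermartingale and Ville's inequality control the whole block at
once. The condition on ψ is what makes the tail of the excess at x at most exp(-ln₊(τ/(KH)))
exp(-c√H x) (`IsPathLaw.measure_excess_le`).

This tail is used twice, and neither use costs a logarithm. For the arm that is best at the start of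
the epoch, integrating it and summing over the geometric grid gives an expected underestimation O(δ)
(`IsPathLaw.sum_integral_maxExcess_le`); only this one fixed arm matters, so there is no union over
arms. For any other arm, if its gap Δ is not explained by drift, underestimation and δ, then a
selection finds it untried, or tried at most O(1/(δΔ)) times, or overestimated by at least Δ/6
(`gap_le_or`). Such selections cost O(1 + 1/δ) per arm in expectation
(`IsPathLaw.integral_armCost_le`), and K/δ = τδ. -/

/-- Bennett's bound on the exponential function. -/
lemma exp_le_one_add_add_sq_mul {y b : ℝ} (hb : 0 < b) (h : |y| ≤ b) :
    Real.exp y ≤ 1 + y + y ^ 2 * ((Real.exp b - 1 - b) / b ^ 2) := by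
  -- The series of exp z - 1 - z is compared termwise at y and b, using y ^ (n + 2) ≤ y ^ 2 * b ^ n.
  have key : ∀ z : ℝ, HasSum (fun n : ℕ => z ^ (n + 2) / ((n + 2).factorial : ℝ))
      (Real.exp z - 1 - z) := by
    intro z
    have h0 : HasSum (fun n : ℕ => z ^ n / (n.factorial : ℝ)) (Real.exp z) := by
      rw [Real.exp_eq_exp_ℝ]
      exact NormedSpace.expSeries_div_hasSum_exp z
    have h1 := (hasSum_nat_add_iff' 2).2 h0
    simpa [Finset.sum_range_succ, sub_sub] using h1
  have h1 := (key b).mul_left (y ^ 2 / b ^ 2)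
  have h2 : Real.exp y - 1 - y ≤ y ^ 2 / b ^ 2 * (Real.exp b - 1 - b) := by
    refine hasSum_le (fun n => ?_) (key y) h1
    have e1 : y ^ 2 / b ^ 2 * (b ^ (n + 2) / ((n + 2).factorial : ℝ))
        = y ^ 2 * b ^ n / ((n + 2).factorial : ℝ) := by
      rw [pow_add]; field_simp
    have e2 : y ^ n ≤ b ^ n := by
      calc y ^ n ≤ |y ^ n| := le_abs_self _
        _ = |y| ^ n := abs_pow y n
        _ ≤ b ^ n := by gcongr
    rw [e1, pow_add, mul_comm (y ^ n)]
    exact div_le_div_of_nonneg_right (mul_le_mul_of_nonneg_left e2 (sq_nonneg y)) (by positivity)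
  have h3 : y ^ 2 / b ^ 2 * (Real.exp b - 1 - b) = y ^ 2 * ((Real.exp b - 1 - b) / b ^ 2) := by
    ring
  linarith

lemma sat_eq {x B : ℝ} (hB : 0 ≤ B) : sat x B = max (-B) (min x B) := by
  unfold sat
  rcases lt_trichotomy x 0 with h | h | h
  · rw [Real.sign_of_neg h, abs_of_neg h, min_eq_left (by linarith : x ≤ B)]
    rcases le_total (-x) B with h1 | h1
    · rw [min_eq_left h1, max_eq_right (by linarith)]; ring
    · rw [min_eq_right h1, max_eq_left (by linarith)]; ring
  · subst h
    simp [hB]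
  · rw [Real.sign_of_pos h, abs_of_pos h, one_mul, max_eq_right]
    exact le_trans (by linarith) (le_min h.le hB)

lemma measurable_sat : Measurable fun p : ℝ × ℝ => sat p.1 p.2 := by
  have h : Measurable Real.sign := by
    unfold Real.sign
    exact Measurable.ite measurableSet_Iio measurable_const
      (Measurable.ite measurableSet_Ioi measurable_const measurable_const)
  unfold sat
  exact (h.comp measurable_fst).mul ((measurable_fst.abs).min measurable_snd)

lemma measurable_sat_left (B : ℝ) : Measurable fun x => sat x B :=
  measurable_sat.comp (measurable_id.prodMk measurable_const)

lemma abs_sat_le {x B : ℝ} (hB : 0 ≤ B) : |sat x B| ≤ B := by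
  rw [sat_eq hB, abs_le]
  exact ⟨le_max_left _ _, max_le (by linarith) (min_le_right _ _)⟩

lemma abs_sat_le_abs {x B : ℝ} (hB : 0 ≤ B) : |sat x B| ≤ |x| := by
  rw [sat_eq hB, abs_le]
  constructor
  · exact (le_min (neg_abs_le x) (by linarith [abs_nonneg x])).trans (le_max_right _ _)
  · exact max_le (by linarith [abs_nonneg x]) ((min_le_left _ _).trans (le_abs_self x))

/-- The error vanishes for |x| ≤ B, and otherwise it is at most |x| ≤ x ^ 2 / B. This turns a bound
on the second moment into a bound on the bias. -/
lemma abs_sat_sub_le {x B : ℝ} (hB : 0 < B) : |sat x B - x| ≤ x ^ 2 / B := by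
  rw [le_div_iff₀ hB, sat_eq hB.le]
  rcases le_total x B with h1 | h1
  · rw [min_eq_left h1]
    rcases le_total (-B) x with h2 | h2
    · rw [max_eq_right h2]; simp; positivity
    · rw [max_eq_left h2, abs_of_nonneg (by linarith)]
      nlinarith
  · rw [min_eq_right h1, max_eq_right (by linarith), abs_of_nonpos (by linarith)]
    nlinarith

/-! ### Saturated random variables with bounded second moment -/

section Saturation

variable {μ : Measure ℝ}

lemma integrable_sq_of_lintegral_le (h : ∫⁻ x, ENNReal.ofReal (x ^ 2) ∂μ ≤ 1) :
    Integrable (fun x : ℝ => x ^ 2) μ := by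
  refine ⟨by fun_prop, ?_⟩
  rw [hasFiniteIntegral_iff_ofReal (Filter.Eventually.of_forall fun x => sq_nonneg x)]
  exact h.trans_lt ENNReal.one_lt_top

lemma integral_sq_le_one (h : ∫⁻ x, ENNReal.ofReal (x ^ 2) ∂μ ≤ 1) :
    ∫ x : ℝ, x ^ 2 ∂μ ≤ 1 := by
  rw [integral_eq_lintegral_of_nonneg_ae (Filter.Eventually.of_forall fun x => sq_nonneg x)
    (by fun_prop)]
  exact ENNReal.toReal_le_of_le_ofReal zero_le_one (by simpa using h)

variable [IsProbabilityMeasure μ]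

lemma integrable_id_of_lintegral_le (h : ∫⁻ x, ENNReal.ofReal (x ^ 2) ∂μ ≤ 1) :
    Integrable (fun x : ℝ => x) μ := by
  refine ((integrable_const (1 : ℝ)).add (integrable_sq_of_lintegral_le h)).mono' (by fun_prop)
    (Filter.Eventually.of_forall fun x => ?_)
  simp only [Real.norm_eq_abs, Pi.add_apply]
  nlinarith [sq_abs x, sq_nonneg (|x| - 1)]

lemma integrable_sat {B : ℝ} (hB : 0 ≤ B) : Integrable (fun x => sat x B) μ :=
  Integrable.of_bound (measurable_sat_left B).aestronglyMeasurable B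
    (Filter.Eventually.of_forall fun _ => abs_sat_le hB)

lemma abs_integral_id_le_one (h : ∫⁻ x, ENNReal.ofReal (x ^ 2) ∂μ ≤ 1) :
    |∫ x : ℝ, x ∂μ| ≤ 1 := by
  refine abs_integral_le_integral_abs.trans ?_
  have h1 : ∫ x : ℝ, |x| ∂μ ≤ ∫ x : ℝ, (1 + x ^ 2) / 2 ∂μ := by
    refine integral_mono (integrable_id_of_lintegral_le h).abs
      (((integrable_const (1 : ℝ)).add (integrable_sq_of_lintegral_le h)).div_const 2)
      fun x => ?_
    simp only
    nlinarith [sq_abs x, sq_nonneg (|x| - 1)]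
  have h2 : ∫ x : ℝ, (1 + x ^ 2) / 2 ∂μ = (1 + ∫ x : ℝ, x ^ 2 ∂μ) / 2 := by
    rw [integral_div, integral_add (integrable_const _) (integrable_sq_of_lintegral_le h)]
    simp
  linarith [integral_sq_le_one h]

lemma abs_integral_sat_sub_le (h : ∫⁻ x, ENNReal.ofReal (x ^ 2) ∂μ ≤ 1) {B : ℝ} (hB : 0 < B) :
    |∫ x, sat x B ∂μ - ∫ x : ℝ, x ∂μ| ≤ 1 / B := by
  rw [← integral_sub (integrable_sat hB.le) (integrable_id_of_lintegral_le h)]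
  calc |∫ x, (sat x B - x) ∂μ| ≤ ∫ x, |sat x B - x| ∂μ := abs_integral_le_integral_abs
    _ ≤ ∫ x, x ^ 2 / B ∂μ :=
      integral_mono ((integrable_sat hB.le).sub (integrable_id_of_lintegral_le h)).abs
        ((integrable_sq_of_lintegral_le h).div_const B) fun x => abs_sat_sub_le hB
    _ ≤ 1 / B := by
      rw [integral_div]
      gcongr
      exact integral_sq_le_one h

/-- Bennett's bound on the moment generating function of a saturated random variable. -/
lemma lintegral_exp_sat_le_one (h : ∫⁻ x, ENNReal.ofReal (x ^ 2) ∂μ ≤ 1) {B b η : ℝ}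
    (hB : 0 ≤ B) (hb : 0 < b) (hη : |η| * (2 * B) ≤ b) :
    ∫⁻ x, ENNReal.ofReal (Real.exp (η * (sat x B - ∫ y, sat y B ∂μ)
      - η ^ 2 * ((Real.exp b - 1 - b) / b ^ 2))) ∂μ ≤ 1 := by
  set m := ∫ y, sat y B ∂μ with hm
  set g := (Real.exp b - 1 - b) / b ^ 2 with hg
  have hg0 : 0 ≤ g := by
    have := Real.add_one_le_exp b
    apply div_nonneg <;> [linarith; positivity]
  have hm_le : |m| ≤ B := by
    refine abs_integral_le_integral_abs.trans ?_
    calc ∫ x, |sat x B| ∂μ ≤ ∫ _, B ∂μ :=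
          integral_mono (integrable_sat hB).abs (integrable_const _) fun x => abs_sat_le hB
      _ = B := by simp
  have hsq : Integrable (fun x => sat x B ^ 2) μ :=
    Integrable.of_bound ((measurable_sat_left B).pow_const 2).aestronglyMeasurable (B ^ 2)
      (Filter.Eventually.of_forall fun x => by
        rw [Real.norm_eq_abs, abs_pow]
        exact pow_le_pow_left₀ (abs_nonneg _) (abs_sat_le hB) 2)
  have hd1 : Integrable (fun x => sat x B - m) μ := (integrable_sat hB).sub (integrable_const _)
  have hd2 : Integrable (fun x => (sat x B - m) ^ 2) μ := by
    have : (fun x => (sat x B - m) ^ 2) = fun x => sat x B ^ 2 - 2 * m * sat x B + m ^ 2 := by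
      ext x; ring
    rw [this]
    exact (hsq.sub ((integrable_sat hB).const_mul _)).add (integrable_const _)
  have hmean : ∫ x, (sat x B - m) ∂μ = 0 := by
    rw [integral_sub (integrable_sat hB) (integrable_const _)]; simp [hm]
  -- Centring and saturating both only decrease the second moment.
  have hvar : ∫ x, (sat x B - m) ^ 2 ∂μ ≤ 1 := by
    have e : ∫ x, (sat x B - m) ^ 2 ∂μ = ∫ x, sat x B ^ 2 ∂μ - m ^ 2 := by
      have : (fun x => (sat x B - m) ^ 2)
          = fun x => sat x B ^ 2 - (2 * m) * (sat x B - m) - m ^ 2 := by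
        ext x; ring
      have hi : Integrable (fun x => sat x B ^ 2 - (2 * m) * (sat x B - m)) μ :=
        hsq.sub (hd1.const_mul _)
      rw [this, integral_sub hi (integrable_const _),
        integral_sub hsq (hd1.const_mul _), integral_const_mul, hmean]
      simp
    have e2 : ∫ x, sat x B ^ 2 ∂μ ≤ ∫ x : ℝ, x ^ 2 ∂μ :=
      integral_mono hsq (integrable_sq_of_lintegral_le h) fun x => by
        simpa using sq_le_sq.2 (abs_sat_le_abs (x := x) hB)
    nlinarith [integral_sq_le_one h, sq_nonneg m]
  have hpt : ∀ x, Real.exp (η * (sat x B - m) - η ^ 2 * g)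
      ≤ Real.exp (-(η ^ 2 * g)) * (1 + η * (sat x B - m) + η ^ 2 * g * (sat x B - m) ^ 2) := by
    intro x
    rw [sub_eq_neg_add, Real.exp_add]
    gcongr
    have hle : |η * (sat x B - m)| ≤ b := by
      rw [abs_mul]
      refine le_trans ?_ hη
      gcongr
      calc |sat x B - m| ≤ |sat x B| + |m| := abs_sub _ _
        _ ≤ 2 * B := by linarith [abs_sat_le (x := x) hB]
    have := exp_le_one_add_add_sq_mul hb hle
    rw [← hg] at this
    nlinarith [this]
  have hint : Integrable (fun x => Real.exp (-(η ^ 2 * g)) *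
      (1 + η * (sat x B - m) + η ^ 2 * g * (sat x B - m) ^ 2)) μ :=
    (((integrable_const _).add (hd1.const_mul _)).add (hd2.const_mul _)).const_mul _
  calc _ ≤ ∫⁻ x, ENNReal.ofReal (Real.exp (-(η ^ 2 * g)) *
      (1 + η * (sat x B - m) + η ^ 2 * g * (sat x B - m) ^ 2)) ∂μ :=
        lintegral_mono fun x => ENNReal.ofReal_le_ofReal (hpt x)
    _ = ENNReal.ofReal (∫ x, Real.exp (-(η ^ 2 * g)) *
      (1 + η * (sat x B - m) + η ^ 2 * g * (sat x B - m) ^ 2) ∂μ) :=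
        (ofReal_integral_eq_lintegral_ofReal hint (Filter.Eventually.of_forall fun x =>
          (Real.exp_pos _).le.trans (hpt x))).symm
    _ ≤ 1 := by
      have hi : Integrable (fun x => 1 + η * (sat x B - m)) μ :=
        (integrable_const _).add (hd1.const_mul _)
      rw [ENNReal.ofReal_le_one, integral_const_mul, integral_add hi (hd2.const_mul _),
        integral_add (integrable_const _) (hd1.const_mul _), integral_const_mul,
        integral_const_mul, hmean]
      simp only [integral_const, probReal_univ, smul_eq_mul, mul_zero, add_zero, mul_one]
      rw [Real.exp_neg, inv_mul_le_iff₀ (Real.exp_pos _), mul_one]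
      have h1 : η ^ 2 * g * ∫ x, (sat x B - m) ^ 2 ∂μ ≤ η ^ 2 * g :=
        mul_le_of_le_one_right (by positivity) hvar
      linarith [Real.add_one_le_exp (η ^ 2 * g)]

end Saturation

/-- A nonnegative random variable with an exponential tail. -/
lemma integrable_and_integral_le_of_exp_tail {Ω : Type*} [MeasurableSpace Ω] {P : Measure Ω}
    {f : Ω → ℝ} (hf : Measurable f) (hf0 : ∀ ω, 0 ≤ f ω) {A β : ℝ} (hA : 0 ≤ A) (hβ : 0 < β)
    (h : ∀ x > 0, P {ω | x < f ω} ≤ ENNReal.ofReal (A * Real.exp (-(β * x)))) :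
    Integrable f P ∧ ∫ ω, f ω ∂P ≤ A / β := by
  have hi : IntegrableOn (fun x => A * Real.exp (-(β * x))) (Set.Ioi 0) := by
    have := (exp_neg_integrableOn_Ioi 0 hβ).const_mul A
    simpa [IntegrableOn] using this
  have hv : ∫ x in Set.Ioi (0 : ℝ), A * Real.exp (-(β * x)) = A / β := by
    rw [integral_const_mul]
    have := integral_exp_mul_Ioi (neg_neg_of_pos hβ) 0
    simp only [neg_mul] at this
    rw [this]; simp; ring
  have hl : ∫⁻ ω, ENNReal.ofReal (f ω) ∂P ≤ ENNReal.ofReal (A / β) := by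
    rw [lintegral_eq_lintegral_meas_lt P (Filter.Eventually.of_forall hf0) hf.aemeasurable, ← hv,
      ofReal_integral_eq_lintegral_ofReal hi (Filter.Eventually.of_forall fun x => by positivity)]
    exact setLIntegral_mono' measurableSet_Ioi fun x hx => h x hx
  refine ⟨⟨hf.aestronglyMeasurable, ?_⟩, ?_⟩
  · rw [hasFiniteIntegral_iff_ofReal (Filter.Eventually.of_forall hf0)]
    exact hl.trans_lt ENNReal.ofReal_lt_top
  · rw [integral_eq_lintegral_of_nonneg_ae (Filter.Eventually.of_forall hf0)
      hf.aestronglyMeasurable]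
    exact ENNReal.toReal_le_of_le_ofReal (by positivity) hl

/-- A two-sided geometric sum is bounded uniformly in its centre. -/
lemma sum_min_geometric_le {b x : ℝ} (hb : 1 < b) (hx : 0 < x) (S : ℕ) :
    ∑ s ∈ Finset.range S, min (b ^ s * x) (1 / (b ^ s * x)) ≤ 2 * (1 + b) / (b - 1) := by
  have hb1 : 0 < b - 1 := by linarith
  -- Up to a constant, the summand is dominated by the increment of the bounded function y / (1 + y)
  -- from y to b * y, so the sum telescopes.
  have step : ∀ y : ℝ, 0 < y → min y (1 / y) ≤
      2 * (1 + b) / (b - 1) * (b * y / (1 + b * y)) - 2 * (1 + b) / (b - 1) * (y / (1 + y)) := by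
    intro y hy
    have e : 2 * (1 + b) / (b - 1) * (b * y / (1 + b * y)) - 2 * (1 + b) / (b - 1) * (y / (1 + y))
        = 2 * (1 + b) * y / ((1 + b * y) * (1 + y)) := by
      have : 0 < 1 + b * y := by positivity
      field_simp
      ring
    have hd : 0 < (1 + b * y) * (1 + y) := by positivity
    rw [e]
    rcases le_total y 1 with h | h
    · refine (min_le_left _ _).trans ?_
      rw [le_div_iff₀ hd, mul_comm y]
      have : (1 + b * y) * (1 + y) ≤ (1 + b) * 2 := by
        apply mul_le_mul _ (by linarith) (by positivity) (by positivity)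
        nlinarith
      nlinarith
    · refine (min_le_right _ _).trans ?_
      rw [div_le_div_iff₀ hy hd]
      have : (1 + b * y) * (1 + y) ≤ ((1 + b) * y) * (2 * y) := by
        apply mul_le_mul _ (by linarith) (by positivity) (by positivity)
        nlinarith
      nlinarith
  have tele : ∀ S : ℕ, ∑ s ∈ Finset.range S, min (b ^ s * x) (1 / (b ^ s * x)) ≤
      2 * (1 + b) / (b - 1) * (b ^ S * x / (1 + b ^ S * x)) := by
    intro S
    induction S with
    | zero => simp; positivity
    | succ S ih =>
      rw [Finset.sum_range_succ]
      have := step (b ^ S * x) (by positivity)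
      rw [← mul_assoc, ← pow_succ'] at this
      linarith
  refine (tele S).trans (mul_le_of_le_one_right (by positivity) ?_)
  have : 0 < b ^ S * x := by positivity
  rw [div_le_one (by positivity)]
  linarith

/-! ### The law of the trajectory -/

section PathLaw

variable {K : ℕ}

instance (π : Policy K) (t : ℕ) : IsMarkovKernel (π.kernel t) := π.markov t

instance (F : Environment K) (t : ℕ) : IsMarkovKernel (rewardKernel F t) :=
  ⟨fun k => by
    change IsProbabilityMeasure (F t k : Measure ℝ)
    infer_instance⟩

/-- The conditional law of the arm and the reward of slot `t`, given the past. -/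
def stepKernel (π : Policy K) (F : Environment K) (t : ℕ) :
    Kernel (History K t) (Fin K × ℝ) :=
  π.kernel t ⊗ₖ Kernel.prodMkLeft (History K t) (rewardKernel F t)

instance (π : Policy K) (F : Environment K) (t : ℕ) : IsMarkovKernel (stepKernel π F t) := by
  unfold stepKernel; infer_instance

/-- The first `t` observations of a trajectory. -/
def past (t : ℕ) (ω : ℕ → Fin K × ℝ) : History K t := fun s => ω s

/-- The trajectory that continues a history by a constant. -/
def extend (d : Fin K × ℝ) {t : ℕ} (h : History K t) : ℕ → Fin K × ℝ :=
  fun n => if hn : n < t then h ⟨n, hn⟩ else d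

lemma measurable_past (t : ℕ) : Measurable (past (K := K) t) := by
  unfold past; fun_prop

lemma measurable_extend (d : Fin K × ℝ) (t : ℕ) :
    Measurable (extend d : History K t → ℕ → Fin K × ℝ) := by
  refine measurable_pi_iff.2 fun n => ?_
  unfold extend
  by_cases hn : n < t
  · simp only [hn, dif_pos]; fun_prop
  · simp only [hn, dif_neg, not_false_eq_true]; fun_prop

lemma past_extend (d : Fin K × ℝ) {t : ℕ} (h : History K t) : past t (extend d h) = h := by
  ext s <;> simp [past, extend]

lemma extend_past_apply (d : Fin K × ℝ) {t s : ℕ} (hs : s < t) (ω : ℕ → Fin K × ℝ) :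
    extend d (past t ω) s = ω s := by
  simp [past, extend, hs]

lemma measurable_snoc (t : ℕ) : Measurable fun p : History K t × (Fin K × ℝ) =>
    (Fin.snoc p.1 p.2 : History K (t + 1)) := by
  refine measurable_pi_iff.2 fun i => ?_
  refine Fin.lastCases ?_ (fun j => ?_) i
  · simp only [Fin.snoc_last]; fun_prop
  · simp only [Fin.snoc_castSucc]; fun_prop

lemma historyLaw_succ (π : Policy K) (F : Environment K) (t : ℕ) :
    historyLaw π F (t + 1) = (historyLaw π F t ⊗ₘ stepKernel π F t).map
      fun p => (Fin.snoc p.1 p.2 : History K (t + 1)) := rfl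

instance (π : Policy K) (F : Environment K) (t : ℕ) :
    IsProbabilityMeasure (historyLaw π F t) := by
  induction t with
  | zero => unfold historyLaw; infer_instance
  | succ t ih =>
    rw [historyLaw_succ]
    exact Measure.isProbabilityMeasure_map (measurable_snoc t).aemeasurable

/-- `P` is a law of trajectories whose first `T` slots are distributed like the interaction of the
policy `π` with the environment `F`. -/
def IsPathLaw (π : Policy K) (F : Environment K) (T : ℕ) (P : Measure (ℕ → Fin K × ℝ)) : Prop :=
  ∀ t ≤ T, P.map (past t) = historyLaw π F t

lemma measurable_init_last (t : ℕ) :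
    Measurable fun h : History K (t + 1) => ((fun s => h s.castSucc : History K t),
      h (Fin.last t)) := by
  fun_prop

lemma historyLaw_succ_map_init_last (π : Policy K) (F : Environment K) (t : ℕ) :
    (historyLaw π F (t + 1)).map (fun h => ((fun s => h s.castSucc : History K t),
      h (Fin.last t))) = historyLaw π F t ⊗ₘ stepKernel π F t := by
  rw [historyLaw_succ, Measure.map_map (measurable_init_last t) (measurable_snoc t)]
  convert Measure.map_id using 2
  ext p : 1
  simp

/-- A single space of infinite sequences carries all prefixes at once, so that counts and sums at
different times can be compared pathwise. Going down from T works because the first marginal of a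
composition product with a Markov kernel is the original measure. -/
lemma isPathLaw_map_extend (π : Policy K) (F : Environment K) (T : ℕ) (d : Fin K × ℝ) :
    IsPathLaw π F T ((historyLaw π F T).map (extend d)) := by
  intro t ht
  induction ht using Nat.decreasingInduction with
  | self =>
    rw [Measure.map_map (measurable_past _) (measurable_extend d _)]
    convert Measure.map_id using 2
    ext h : 1
    exact past_extend d h
  | of_succ t ht ih =>
    have e : past (K := K) t = Prod.fst ∘ (fun h : History K (t + 1) =>
        ((fun s => h s.castSucc : History K t), h (Fin.last t))) ∘ past (t + 1) := rfl
    rw [e, ← Measure.map_map measurable_fst ((measurable_init_last t).comp (measurable_past _)),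
      ← Measure.map_map (measurable_init_last t) (measurable_past _), ih,
      historyLaw_succ_map_init_last]
    exact Measure.fst_compProd _ _

variable {π : Policy K} {F : Environment K} {T : ℕ} {P : Measure (ℕ → Fin K × ℝ)}

lemma IsPathLaw.isProbabilityMeasure (hP : IsPathLaw π F T P) : IsProbabilityMeasure P := by
  have h : IsProbabilityMeasure (P.map (past 0)) := by
    rw [hP 0 (Nat.zero_le _)]; infer_instance
  exact (Measure.isProbabilityMeasure_map_iff (measurable_past 0).aemeasurable).1 h

lemma IsPathLaw.map_past_prod (hP : IsPathLaw π F T P) {t : ℕ} (ht : t < T) :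
    P.map (fun ω => (past t ω, ω t)) = historyLaw π F t ⊗ₘ stepKernel π F t := by
  have e : (fun ω : ℕ → Fin K × ℝ => (past t ω, ω t)) = (fun h : History K (t + 1) =>
        ((fun s => h s.castSucc : History K t), h (Fin.last t))) ∘ past (t + 1) := rfl
  rw [e, ← Measure.map_map (measurable_init_last t) (measurable_past _), hP (t + 1) ht,
      historyLaw_succ_map_init_last]

lemma measurable_past_prod (t : ℕ) :
    Measurable fun ω : ℕ → Fin K × ℝ => (past t ω, ω t) :=
  (measurable_past t).prodMk (measurable_pi_apply t)

lemma lintegral_stepKernel {t : ℕ} (h : History K t) {g : Fin K × ℝ → ENNReal}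
    (hg : Measurable g) :
    ∫⁻ p, g p ∂stepKernel π F t h = ∫⁻ k, ∫⁻ x, g (k, x) ∂(F t k : Measure ℝ) ∂π.kernel t h := by
  unfold stepKernel
  rw [Kernel.lintegral_compProd _ _ _ hg]
  rfl

/-- A function of the past is multiplied by a reward factor of conditional expectation at most
`1`. -/
lemma IsPathLaw.lintegral_mul_le (hP : IsPathLaw π F T P) (d : Fin K × ℝ) {t : ℕ} (ht : t < T)
    {f : (ℕ → Fin K × ℝ) → ENNReal} (hf : Measurable f)
    (hadapt : ∀ ω ω', (∀ s < t, ω s = ω' s) → f ω = f ω')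
    {g : Fin K × ℝ → ENNReal} (hg : Measurable g)
    (hg1 : ∀ k, ∫⁻ x, g (k, x) ∂(F t k : Measure ℝ) ≤ 1) :
    ∫⁻ ω, f ω * g (ω t) ∂P ≤ ∫⁻ ω, f ω ∂P := by
  have hfe : ∀ ω, f ω = f (extend d (past t ω)) := fun ω =>
    hadapt _ _ fun s hs => (extend_past_apply d hs ω).symm
  have hf' : Measurable fun h : History K t => f (extend d h) := hf.comp (measurable_extend d t)
  calc ∫⁻ ω, f ω * g (ω t) ∂P
      = ∫⁻ ω, (fun p : History K t × (Fin K × ℝ) => f (extend d p.1) * g p.2)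
          (past t ω, ω t) ∂P := lintegral_congr fun ω => by simp only; rw [← hfe]
    _ = ∫⁻ h, ∫⁻ p, f (extend d h) * g p ∂stepKernel π F t h ∂historyLaw π F t := by
      have hm : Measurable fun p : History K t × (Fin K × ℝ) => f (extend d p.1) * g p.2 :=
        (hf'.comp measurable_fst).mul (hg.comp measurable_snd)
      rw [← lintegral_map hm (measurable_past_prod t), hP.map_past_prod ht,
        Measure.lintegral_compProd hm]
    _ ≤ ∫⁻ h, f (extend d h) ∂historyLaw π F t := by
      refine lintegral_mono fun h => ?_
      rw [lintegral_const_mul _ hg, lintegral_stepKernel h hg]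
      refine mul_le_of_le_one_right zero_le ?_
      calc _ ≤ ∫⁻ _, 1 ∂π.kernel t h := lintegral_mono fun k => hg1 k
        _ = 1 := by simp
    _ = ∫⁻ ω, f ω ∂P := by
      rw [← hP t ht.le, lintegral_map hf' (measurable_past t)]
      exact lintegral_congr fun ω => (hfe ω).symm

/-- Ville's inequality for a sum of increments whose exponentials have conditional expectations at
most `1`. -/
lemma IsPathLaw.measure_exists_le_sum (hP : IsPathLaw π F T P) (d : Fin K × ℝ)
    {inc : ℕ → Fin K × ℝ → ℝ} (hinc : ∀ t, Measurable (inc t))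
    (h1 : ∀ t < T, ∀ k, ∫⁻ x, ENNReal.ofReal (Real.exp (inc t (k, x))) ∂(F t k : Measure ℝ) ≤ 1)
    (θ : ℝ) :
    P {ω | ∃ t ≤ T, θ ≤ ∑ s ∈ Finset.range t, inc s (ω s)} ≤ ENNReal.ofReal (Real.exp (-θ)) := by
  have := hP.isProbabilityMeasure
  set U : ℕ → (ℕ → Fin K × ℝ) → ℝ := fun t ω => ∑ s ∈ Finset.range t, inc s (ω s) with hU
  have hUm : ∀ t, Measurable (U t) := fun t =>
    Finset.measurable_sum _ fun s _ => (hinc s).comp (measurable_pi_apply s)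
  set A : ℕ → Set (ℕ → Fin K × ℝ) := fun t => {ω | ∃ s ≤ t, θ ≤ U s ω} with hA
  have hAm : ∀ t, MeasurableSet (A t) := fun t => by
    have : A t = ⋃ s, ⋃ (_ : s ≤ t), {ω | θ ≤ U s ω} := by ext; simp [hA]
    rw [this]
    exact MeasurableSet.iUnion fun s => MeasurableSet.iUnion fun _ =>
      measurableSet_le measurable_const (hUm s)
  have hUa : ∀ t ω ω', (∀ s < t, ω s = ω' s) → U t ω = U t ω' := fun t ω ω' h =>
    Finset.sum_congr rfl fun s hs => by rw [h s (Finset.mem_range.1 hs)]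
  have hAa : ∀ t ω ω', (∀ s < t, ω s = ω' s) → (ω ∈ A t ↔ ω' ∈ A t) := fun t ω ω' h =>
    exists_congr fun s => and_congr_right fun hs => by
      rw [hUa s ω ω' fun r hr => h r (hr.trans_le hs)]
  set c : ENNReal := ENNReal.ofReal (Real.exp θ) with hc
  set E : ℕ → (ℕ → Fin K × ℝ) → ENNReal := fun t ω => ENNReal.ofReal (Real.exp (U t ω)) with hE
  have hEm : ∀ t, Measurable (E t) := fun t => (Real.measurable_exp.comp (hUm t)).ennreal_ofReal
  -- The supermartingale is stopped when it first reaches level c and is then replaced by c. On a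
  -- first passage at t + 1 this replacement only lowers the value, so the expectation stays at most
  -- 1.
  have main : ∀ t ≤ T, ∫⁻ ω, (A t).indicator (fun _ => c) ω ∂P
      + ∫⁻ ω, (A t)ᶜ.indicator (E t) ω ∂P ≤ 1 := by
    intro t
    induction t with
    | zero =>
      intro _
      rw [← lintegral_add_left (measurable_const.indicator (hAm 0))]
      calc _ ≤ ∫⁻ _, 1 ∂P := by
            refine lintegral_mono fun ω => ?_
            by_cases h : ω ∈ A 0
            · have h0 : θ ≤ 0 := by simpa [hA, hU] using h
              simp [h, hc, h0]
            · simp [h, hE, hU]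
        _ = 1 := by simp
    | succ t ih =>
      intro ht
      refine le_trans ?_ (ih (by omega))
      have hf : Measurable ((A t)ᶜ.indicator (E t)) := (hEm t).indicator (hAm t).compl
      have hg : Measurable fun p => ENNReal.ofReal (Real.exp (inc t p)) :=
        (Real.measurable_exp.comp (hinc t)).ennreal_ofReal
      have key := hP.lintegral_mul_le d (t := t) ht hf (fun ω ω' h => by
        have e1 := hAa t ω ω' h
        have e2 := hUa t ω ω' h
        by_cases hω : ω ∈ A t
        · have hω' := e1.1 hω
          simp [hω, hω']
        · have hω' : ω' ∉ A t := fun h' => hω (e1.2 h')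
          simp [hω, hω', hE, e2]) hg (h1 t ht)
      refine le_trans ?_ (add_le_add_right key _)
      rw [← lintegral_add_left (measurable_const.indicator (hAm _)),
        ← lintegral_add_left (measurable_const.indicator (hAm _))]
      refine lintegral_mono fun ω => ?_
      have hsub : ω ∈ A t → ω ∈ A (t + 1) := fun ⟨s, hs, h⟩ => ⟨s, by omega, h⟩
      have hmul : E t ω * ENNReal.ofReal (Real.exp (inc t (ω t))) = E (t + 1) ω := by
        simp only [hE, hU, Finset.sum_range_succ]
        rw [Real.exp_add, ENNReal.ofReal_mul (Real.exp_pos _).le]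
      by_cases hω : ω ∈ A t
      · simp [hω, hsub hω]
      · by_cases hω' : ω ∈ A (t + 1)
        · simp only [hω, hω', Set.indicator_of_mem, Set.indicator_of_notMem, Set.mem_compl_iff,
            not_true_eq_false, not_false_eq_true, add_zero, zero_add, hmul]
          obtain ⟨s, hs, h⟩ := hω'
          have : s = t + 1 := by
            by_contra hne
            exact hω ⟨s, by omega, h⟩
          subst this
          exact ENNReal.ofReal_le_ofReal (Real.exp_le_exp.2 h)
        · simp [hω, hω', hmul]
  have h2 : c * P (A T) ≤ 1 := by
    refine le_trans ?_ (main T le_rfl)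
    rw [lintegral_indicator_const (hAm T)]
    exact le_self_add
  have h3 : ENNReal.ofReal (Real.exp (-θ)) * c = 1 := by
    rw [hc, ← ENNReal.ofReal_mul (Real.exp_pos _).le, ← Real.exp_add]; simp
  calc P (A T) = ENNReal.ofReal (Real.exp (-θ)) * (c * P (A T)) := by
        rw [← mul_assoc, h3, one_mul]
    _ ≤ ENNReal.ofReal (Real.exp (-θ)) * 1 := by gcongr
    _ = _ := mul_one _

/-! ### Expected rewards -/

lemma IsPathLaw.integral_eq (hP : IsPathLaw π F T P) {t : ℕ} (ht : t < T)
    {g : Fin K × ℝ → ℝ} (hg : Measurable g) (hi : Integrable (fun ω => g (ω t)) P) :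
    ∫ ω, g (ω t) ∂P = ∫ h, ∫ k, ∫ x, g (k, x) ∂(F t k : Measure ℝ) ∂π.kernel t h
      ∂historyLaw π F t := by
  have hm : Measurable fun p : History K t × (Fin K × ℝ) => g p.2 := hg.comp measurable_snd
  have hi2 : Integrable (fun p : History K t × (Fin K × ℝ) => g p.2)
      (historyLaw π F t ⊗ₘ stepKernel π F t) := by
    rw [← hP.map_past_prod ht, integrable_map_measure hm.aestronglyMeasurable
      (measurable_past_prod t).aemeasurable]
    exact hi
  have e : ∫ ω, g (ω t) ∂P
      = ∫ p, g p.2 ∂(historyLaw π F t ⊗ₘ stepKernel π F t) := by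
    rw [← hP.map_past_prod ht, integral_map (measurable_past_prod t).aemeasurable
      hm.aestronglyMeasurable]
  rw [e, Measure.integral_compProd hi2]
  refine integral_congr_ae ?_
  filter_upwards [((Measure.integrable_compProd_iff hm.aestronglyMeasurable).1 hi2).1] with h hh
  unfold stepKernel at hh ⊢
  rw [ProbabilityTheory.integral_compProd hh]
  rfl

lemma abs_mean_le_one (hF : HeavyTailed F T) {t : ℕ} (ht : t < T) (k : Fin K) :
    |mean F t k| ≤ 1 :=
  abs_integral_id_le_one (hF t ht k)

lemma integrable_comp_arm [IsFiniteMeasure P] (f : Fin K → ℝ) (t : ℕ) :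
    Integrable (fun ω => f (ω t).1) P := by
  refine Integrable.of_bound ((Measurable.of_discrete (f := f)).comp
    (measurable_fst.comp (measurable_pi_apply t))).aestronglyMeasurable (∑ k, |f k|)
    (Filter.Eventually.of_forall fun ω => ?_)
  exact Finset.single_le_sum (f := fun k => |f k|) (fun _ _ => abs_nonneg _) (Finset.mem_univ _)

lemma IsPathLaw.integrable_reward (hP : IsPathLaw π F T P) (hF : HeavyTailed F T) {t : ℕ}
    (ht : t < T) : Integrable (fun ω => (ω t).2) P := by
  have hm : Measurable fun ω : ℕ → Fin K × ℝ => (ω t).2 :=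
    measurable_snd.comp (measurable_pi_apply t)
  have := hP.isProbabilityMeasure
  have hsq : ∫⁻ ω, ENNReal.ofReal ((ω t).2 ^ 2) ∂P ≤ 1 := by
    rcases isEmpty_or_nonempty (Fin K) with hK | ⟨⟨k0⟩⟩
    · have : IsEmpty (ℕ → Fin K × ℝ) := ⟨fun ω => hK.elim (ω 0).1⟩
      rw [lintegral_of_isEmpty]; simp
    · have := hP.lintegral_mul_le (k0, 0) ht (f := fun _ => 1) measurable_const
        (fun _ _ _ => rfl) (g := fun p => ENNReal.ofReal (p.2 ^ 2)) (by fun_prop) (hF t ht)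
      simpa using this
  have h2 : Integrable (fun ω : ℕ → Fin K × ℝ => (ω t).2 ^ 2) P := by
    refine ⟨(hm.pow_const 2).aestronglyMeasurable, ?_⟩
    rw [hasFiniteIntegral_iff_ofReal (Filter.Eventually.of_forall fun ω => sq_nonneg _)]
    exact hsq.trans_lt ENNReal.one_lt_top
  refine ((integrable_const (1 : ℝ)).add h2).mono' hm.aestronglyMeasurable
    (Filter.Eventually.of_forall fun ω => ?_)
  simp only [Real.norm_eq_abs, Pi.add_apply]
  nlinarith [sq_abs (ω t).2, sq_nonneg (|(ω t).2| - 1)]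

lemma IsPathLaw.integral_reward (hP : IsPathLaw π F T P) (hF : HeavyTailed F T) {t : ℕ}
    (ht : t < T) : ∫ ω, (ω t).2 ∂P = ∫ ω, mean F t (ω t).1 ∂P := by
  have := hP.isProbabilityMeasure
  rw [hP.integral_eq ht (g := fun p => p.2) measurable_snd (hP.integrable_reward hF ht),
    hP.integral_eq ht (g := fun p => mean F t p.1)
      ((Measurable.of_discrete (f := mean F t)).comp measurable_fst) (integrable_comp_arm _ t)]
  simp [mean]

/-- The regret is the expected sum of the gaps of the selected arms. -/
lemma IsPathLaw.regret_eq (hP : IsPathLaw π F T P) (hF : HeavyTailed F T) :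
    regret π F T = ∫ ω, ∑ t ∈ Finset.range T, (bestMean F t - mean F t (ω t).1) ∂P := by
  have := hP.isProbabilityMeasure
  have e1 : ∫ h, ∑ t : Fin T, (h t).2 ∂(historyLaw π F T)
      = ∑ t ∈ Finset.range T, ∫ ω, mean F t (ω t).1 ∂P := by
    rw [← hP T le_rfl, integral_map (measurable_past T).aemeasurable
      (by fun_prop : Measurable fun h : History K T => ∑ t : Fin T, (h t).2).aestronglyMeasurable]
    have : ∀ ω : ℕ → Fin K × ℝ, ∑ t : Fin T, (past T ω t).2 = ∑ t ∈ Finset.range T, (ω t).2 :=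
      fun ω => Fin.sum_univ_eq_sum_range (fun t => (ω t).2) T
    simp_rw [this]
    rw [integral_finsetSum _ fun t ht => hP.integrable_reward hF (Finset.mem_range.1 ht)]
    exact Finset.sum_congr rfl fun t ht => hP.integral_reward hF (Finset.mem_range.1 ht)
  have hi : ∀ t ∈ Finset.range T,
      Integrable (fun ω : ℕ → Fin K × ℝ => bestMean F t - mean F t (ω t).1) P := fun t _ =>
    (integrable_const _).sub (integrable_comp_arm _ t)
  rw [regret, e1, integral_finsetSum _ hi, ← Finset.sum_sub_distrib]
  refine Finset.sum_congr rfl fun t _ => ?_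
  rw [integral_sub (integrable_const _) (integrable_comp_arm _ t)]
  simp

/-! ### Admissibility along the trajectory -/

lemma measurableSet_pulled {t : ℕ} (τ : ℕ) (k : Fin K) (s : Fin t) :
    MeasurableSet {h : History K t | (s : ℕ) / τ = t / τ ∧ (h s).1 = k} :=
  (MeasurableSet.const _).inter
    ((measurable_fst.comp (measurable_pi_apply s)) (measurableSet_singleton k))

lemma measurable_card_pulls {t : ℕ} (τ : ℕ) (k : Fin K) :
    Measurable fun h : History K t => (pulls τ h k).card := by
  simp only [pulls, Finset.card_filter]
  exact Finset.measurable_sum _ fun s _ =>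
    Measurable.ite (measurableSet_pulled τ k s) measurable_const measurable_const

lemma measurable_ucb {t : ℕ} (a ζ : ℝ) (τ : ℕ) (k : Fin K) :
    Measurable fun h : History K t => ucb a ζ τ h k := by
  have hc := measurable_card_pulls (t := t) τ k
  have hS : Measurable fun h : History K t =>
      ∑ s ∈ pulls τ h k, sat (h s).2 (satLimit a τ K (pulls τ h k).card) := by
    have e : ∀ h : History K t,
        ∑ s ∈ pulls τ h k, sat (h s).2 (satLimit a τ K (pulls τ h k).card)
        = ∑ s : Fin t, if (s : ℕ) / τ = t / τ ∧ (h s).1 = k then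
          sat (h s).2 (satLimit a τ K (pulls τ h k).card) else 0 := fun h => by
      conv_lhs => rw [pulls, Finset.sum_filter]
      rfl
    simp_rw [e]
    refine Finset.measurable_sum _ fun s _ =>
      Measurable.ite (measurableSet_pulled τ k s) ?_ measurable_const
    exact measurable_sat.comp ((measurable_snd.comp (measurable_pi_apply s)).prodMk
      ((Measurable.of_discrete (f := satLimit a τ K)).comp hc))
  unfold ucb satMean
  exact (hS.div ((Measurable.of_discrete (f := fun n : ℕ => (n : ℝ))).comp hc)).add
    (((Measurable.of_discrete (f := confWidth τ K)).comp hc).const_mul _)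

lemma measurableSet_admissible {t : ℕ} (a ζ : ℝ) (τ : ℕ) (k : Fin K) :
    MeasurableSet {h : History K t | Admissible a ζ τ h k} := by
  have h0 : ∀ j : Fin K, MeasurableSet {h : History K t | pulls τ h j = ∅} := fun j => by
    have : {h : History K t | pulls τ h j = ∅} =
        (fun h : History K t => (pulls τ h j).card) ⁻¹' {0} := by ext h; simp
    rw [this]
    exact measurable_card_pulls τ j (measurableSet_singleton 0)
  have h1 : {h : History K t | Admissible a ζ τ h k} = {h | pulls τ h k = ∅} ∪
      ((⋂ j, {h | pulls τ h j = ∅}ᶜ) ∩ ⋂ j, {h | ucb a ζ τ h j ≤ ucb a ζ τ h k}) := by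
    ext h; simp [Admissible]
  rw [h1]
  exact (h0 k).union ((MeasurableSet.iInter fun j => (h0 j).compl).inter
    (MeasurableSet.iInter fun j => measurableSet_le (measurable_ucb a ζ τ j)
      (measurable_ucb a ζ τ k)))

/-- Admissibility is given kernelwise for every history; measurability of the admissible set lets it
pass through the composition product to almost every trajectory. -/
lemma IsPathLaw.ae_admissible (hP : IsPathLaw π F T P) {a ζ : ℝ} {τ : ℕ}
    (hπ : IsRRMOSS a ζ τ π) :
    ∀ᵐ ω ∂P, ∀ t < T, Admissible a ζ τ (past t ω) (ω t).1 := by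
  refine ae_all_iff.2 fun t => ?_
  by_cases ht : t < T
  swap
  · simp [ht]
  have hm : MeasurableSet {p : History K t × (Fin K × ℝ) | Admissible a ζ τ p.1 p.2.1} := by
    have : {p : History K t × (Fin K × ℝ) | Admissible a ζ τ p.1 p.2.1} =
        ⋃ k, ({p | p.2.1 = k} ∩ Prod.fst ⁻¹' {h | Admissible a ζ τ h k}) := by
      ext p; simp
    rw [this]
    exact MeasurableSet.iUnion fun k =>
      ((measurable_fst.comp measurable_snd) (measurableSet_singleton k)).inter
        (measurable_fst (measurableSet_admissible a ζ τ k))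
  have h1 : ∀ᵐ p ∂(P.map (fun ω => (past t ω, ω t))), Admissible a ζ τ p.1 p.2.1 := by
    rw [hP.map_past_prod ht, Measure.ae_compProd_iff hm]
    refine Filter.Eventually.of_forall fun h => ?_
    have hm2 : MeasurableSet {p : Fin K × ℝ | Admissible a ζ τ h p.1} :=
      measurable_fst (MeasurableSet.of_discrete (s := {k | Admissible a ζ τ h k}))
    unfold stepKernel
    rw [Kernel.ae_compProd_iff hm2]
    filter_upwards [hπ t h] with k hk
    exact Filter.Eventually.of_forall fun _ => hk
  filter_upwards [ae_of_ae_map (measurable_past_prod t).aemeasurable h1] with ω hω _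
  exact hω

end PathLaw

/-! ### Confidence widths and saturation limits -/

lemma one_le_lnPlus (x : ℝ) : 1 ≤ lnPlus x := le_max_right _ _

lemma lnPlus_pos (x : ℝ) : 0 < lnPlus x := zero_lt_one.trans_le (one_le_lnPlus x)

lemma lnPlus_mono {x y : ℝ} (hx : 0 < x) (h : x ≤ y) : lnPlus x ≤ lnPlus y :=
  max_le_max_right _ (Real.log_le_log hx h)

lemma exp_neg_lnPlus_le_one (x : ℝ) : Real.exp (-lnPlus x) ≤ 1 :=
  Real.exp_le_one_iff.2 (by linarith [lnPlus_pos x])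

lemma exp_neg_lnPlus_le_inv {x : ℝ} (hx : 0 < x) : Real.exp (-lnPlus x) ≤ x⁻¹ := by
  calc Real.exp (-lnPlus x) ≤ Real.exp (-Real.log x) :=
        Real.exp_le_exp.2 (neg_le_neg (le_max_left _ _))
    _ = x⁻¹ := by rw [Real.exp_neg, Real.exp_log hx]

/-- Follows from log x = 2 log √x and the tangent bound for log (√x / 2). Replacing the logarithm by
a square root is affordable because the burn-in only has to be O(1 / (δ * Δ)). -/
lemma lnPlus_le_one_add_sqrt {x : ℝ} (hx : 0 < x) : lnPlus x ≤ 1 + √x := by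
  refine max_le ?_ (by linarith [Real.sqrt_nonneg x])
  have h1 : Real.log x = 2 * Real.log √x := by rw [Real.log_sqrt hx.le]; ring
  have h2 := Real.log_le_sub_one_of_pos (x := √x / 2) (by positivity)
  have h3 : Real.log (√x / 2) = Real.log √x - Real.log 2 := Real.log_div (by positivity) (by simp)
  have h4 := Real.log_two_lt_d9
  linarith

lemma gridUp_pos {a : ℝ} (ha : 1 < a) (m : ℕ) : 0 < gridUp a m :=
  zpow_pos (by linarith) _

lemma le_gridUp {a : ℝ} (ha : 1 < a) {m : ℕ} (hm : 0 < m) : (m : ℝ) ≤ gridUp a m := by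
  have hm' : (0 : ℝ) < m := by exact_mod_cast hm
  have h := (Int.lt_floor_add_one (Real.logb a m)).le
  unfold gridUp
  rw [Real.logb_le_iff_le_rpow ha hm'] at h
  exact_mod_cast h

lemma gridUp_le {a : ℝ} (ha : 1 < a) {m : ℕ} (hm : 0 < m) : gridUp a m ≤ a * m := by
  have hm' : (0 : ℝ) < m := by exact_mod_cast hm
  have h := Int.floor_le (Real.logb a m)
  rw [Real.le_logb_iff_rpow_le ha hm'] at h
  unfold gridUp
  rw [zpow_add₀ (by linarith), zpow_one, mul_comm]
  gcongr
  exact_mod_cast h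

/-- A positive count has a nonnegative logarithm, so its grid point is a natural power of a; counts
up to N therefore meet only finitely many blocks, with indices known in advance. -/
lemma gridUp_eq_pow {a : ℝ} (ha : 1 < a) {m N : ℕ} (hm : 0 < m) (hmN : m ≤ N) :
    ∃ s ∈ Finset.range (⌊Real.logb a N⌋₊ + 1), gridUp a m = a ^ (s + 1) := by
  refine ⟨⌊Real.logb a m⌋₊, ?_, ?_⟩
  · rw [Finset.mem_range, Nat.lt_succ_iff]
    exact Nat.floor_mono (Real.logb_le_logb_of_le ha (by exact_mod_cast hm)
      (by exact_mod_cast hmN))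
  · have h0 : 0 ≤ Real.logb a m := Real.logb_nonneg ha (by exact_mod_cast hm)
    unfold gridUp
    rw [← Int.natCast_floor_eq_floor h0]
    exact_mod_cast rfl

/-- The saturation limit as a function of the grid point. -/
def gridLimit (τ K : ℕ) (H : ℝ) : ℝ := √(H / lnPlus (τ / (K * H)))

lemma satLimit_eq (a : ℝ) (τ K m : ℕ) : satLimit a τ K m = gridLimit τ K (gridUp a m) := rfl

lemma gridLimit_pos (τ K : ℕ) {H : ℝ} (hH : 0 < H) : 0 < gridLimit τ K H :=
  Real.sqrt_pos.2 (div_pos hH (lnPlus_pos _))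

/-- The saturation bias 1 / B is absorbed by one confidence width. This accounts for the 1 in the
factor 1 + ζ of the index, while ζ is left for the deviation. -/
lemma inv_gridLimit_le_confWidth {τ K m : ℕ} (hτ : 0 < τ) (hK : 0 < K) (hm : 0 < m) {H : ℝ}
    (h : (m : ℝ) ≤ H) : 1 / gridLimit τ K H ≤ confWidth τ K m := by
  have hm' : (0 : ℝ) < m := by exact_mod_cast hm
  have hτ' : (0 : ℝ) < τ := by exact_mod_cast hτ
  have hK' : (0 : ℝ) < K := by exact_mod_cast hK
  have hH : 0 < H := hm'.trans_le h
  unfold gridLimit confWidth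
  rw [one_div, ← Real.sqrt_inv, inv_div]
  apply Real.sqrt_le_sqrt
  have : lnPlus (τ / (K * H)) ≤ lnPlus (τ / (K * m)) :=
    lnPlus_mono (by positivity) (by gcongr)
  exact div_le_div₀ (lnPlus_pos _).le this hm' h

/-! ### Deviations of the saturated sums -/

/-- The slots `s < t` of epoch `e` in which arm `k` was selected. -/
def armSlots {K : ℕ} (τ e : ℕ) (k : Fin K) (t : ℕ) (ω : ℕ → Fin K × ℝ) : Finset ℕ :=
  {s ∈ Finset.range t | s / τ = e ∧ (ω s).1 = k}

/-- The centred sum of the rewards of arm `k` in epoch `e`, saturated at level `B`. -/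
def deviation {K : ℕ} (F : Environment K) (τ e : ℕ) (k : Fin K) (B : ℝ) (t : ℕ)
    (ω : ℕ → Fin K × ℝ) : ℝ :=
  ∑ s ∈ armSlots τ e k t ω, (sat (ω s).2 B - ∫ x, sat x B ∂(F s k : Measure ℝ))

/-- The excess of the (signed) mean deviation of arm `k` over `ζ` times its confidence width. -/
def excess {K : ℕ} (F : Environment K) (ζ : ℝ) (τ e : ℕ) (k : Fin K) (ε B : ℝ) (t : ℕ)
    (ω : ℕ → Fin K × ℝ) : ℝ :=
  ε * deviation F τ e k B t ω / (armSlots τ e k t ω).card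
    - ζ * confWidth τ K (armSlots τ e k t ω).card

/-- The rate of the exponential tail of `excess`. -/
def devRate (a ζ : ℝ) : ℝ := Real.log (1 + 2 * ζ / a) / (2 * a)

lemma devRate_pos {a ζ : ℝ} (ha : 1 < a) (hζ : 0 < ζ) : 0 < devRate a ζ := by
  have : 0 < 2 * ζ / a := by positivity
  exact div_pos (Real.log_pos (by linarith)) (by linarith)

section Deviation

variable {K : ℕ} {π : Policy K} {F : Environment K} {T : ℕ} {P : Measure (ℕ → Fin K × ℝ)}

lemma measurableSet_arm (τ e s : ℕ) (k : Fin K) :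
    MeasurableSet {ω : ℕ → Fin K × ℝ | s / τ = e ∧ (ω s).1 = k} :=
  (MeasurableSet.const _).inter
    ((measurable_fst.comp (measurable_pi_apply s)) (measurableSet_singleton k))

lemma measurable_card_armSlots (τ e : ℕ) (k : Fin K) (t : ℕ) :
    Measurable fun ω => (armSlots τ e k t ω).card := by
  simp only [armSlots, Finset.card_filter]
  exact Finset.measurable_sum _ fun s _ =>
    Measurable.ite (measurableSet_arm τ e s k) measurable_const measurable_const

lemma measurable_deviation (F : Environment K) (τ e : ℕ) (k : Fin K) (B : ℝ) (t : ℕ) :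
    Measurable (deviation F τ e k B t) := by
  unfold deviation
  simp only [armSlots, Finset.sum_filter]
  exact Finset.measurable_sum _ fun s _ => Measurable.ite (measurableSet_arm τ e s k)
    (((measurable_sat_left B).comp (measurable_snd.comp (measurable_pi_apply s))).sub_const _)
    measurable_const

lemma measurable_excess (F : Environment K) (ζ : ℝ) (τ e : ℕ) (k : Fin K) (ε B : ℝ) (t : ℕ) :
    Measurable (excess F ζ τ e k ε B t) := by
  have hc := measurable_card_armSlots τ e k t
  unfold excess
  exact (((measurable_deviation F τ e k B t).const_mul _).div
    ((Measurable.of_discrete (f := fun n : ℕ => (n : ℝ))).comp hc)).sub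
    (((Measurable.of_discrete (f := confWidth τ K)).comp hc).const_mul _)

/-- The exponent of the deviation bound on the block of counts with grid point `H`. -/
lemma deviation_exponent {a ζ : ℝ} (ha : 1 < a) (hζ : 0 < ζ) (hψ : psi (2 * ζ / a) ≥ 2 * a / ζ)
    {L H B n x D : ℝ} (hH : 0 < H) (hL : 1 ≤ L) (hB : B = √(H / L)) (hn : n ≤ H)
    (hHn : H ≤ a * n) (hx : 0 ≤ x) (hD : n * (ζ * (1 / B) + x) ≤ D) :
    L + devRate a ζ * √H * x ≤ Real.log (1 + 2 * ζ / a) / (2 * B) * D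
      - (2 * ζ / a - Real.log (1 + 2 * ζ / a)) / (4 * B ^ 2) * n := by
  set u := 2 * ζ / a with hu
  set ℓ := Real.log (1 + u) with hℓ
  have ha0 : 0 < a := by linarith
  have hu0 : 0 < u := by positivity
  have hℓ0 : 0 < ℓ := Real.log_pos (by linarith)
  have hℓu : ℓ ≤ u := by
    have := Real.log_le_sub_one_of_pos (x := 1 + u) (by linarith)
    linarith
  have hL0 : 0 < L := by linarith
  have hB0 : 0 < B := by rw [hB]; positivity
  have hB2 : B ^ 2 = H / L := by rw [hB, Real.sq_sqrt (by positivity)]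
  -- The hypothesis on ψ, rewritten with 2 * a / ζ = 4 / u.
  have h4 : 4 ≤ (1 + u) * ℓ - u := by
    have h1 : psi u = ((1 + u) * ℓ - u) / u := by
      unfold psi; field_simp; rw [hℓ]; ring
    rw [h1, ge_iff_le, le_div_iff₀ hu0] at hψ
    have : 2 * a / ζ * u = 4 := by rw [hu]; field_simp; norm_num
    linarith
  have hHB : √H ≤ H / B := by
    rw [le_div_iff₀ hB0, hB]
    calc √H * √(H / L) ≤ √H * √H := by
          gcongr
          exact div_le_self hH.le hL
      _ = H := Real.mul_self_sqrt hH.le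
  have hLe : H / B ^ 2 = L := by rw [hB2]; field_simp
  -- The gain term uses n ≥ H / a and the variance term below uses n ≤ H. The coefficients of L then
  -- combine to ((1 + u) * ℓ - u) / 4 ≥ 1.
  have e1 : ℓ / (2 * B) * (H / a * (ζ * (1 / B) + x)) ≤ ℓ / (2 * B) * D := by
    refine mul_le_mul_of_nonneg_left (le_trans ?_ hD) (by positivity)
    refine mul_le_mul_of_nonneg_right ?_ (by positivity)
    rw [div_le_iff₀ ha0]; linarith
  have e2 : ℓ / (2 * B) * (H / a * (ζ * (1 / B) + x)) = ℓ * u / 4 * L + ℓ / (2 * a) * (H / B) * x := by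
    rw [← hLe, hu]; field_simp; ring
  have e3 : (u - ℓ) / (4 * B ^ 2) * n ≤ (u - ℓ) / 4 * L := by
    have : (u - ℓ) / 4 * L = (u - ℓ) / (4 * B ^ 2) * H := by rw [← hLe]; field_simp
    rw [this]
    exact mul_le_mul_of_nonneg_left hn (div_nonneg (by linarith) (by positivity))
  have e4 : devRate a ζ * √H * x ≤ ℓ / (2 * a) * (H / B) * x := by
    unfold devRate
    rw [← hu, ← hℓ]
    gcongr
  have e5 : L ≤ ℓ * u / 4 * L - (u - ℓ) / 4 * L := by nlinarith
  linarith

/-- The maximal inequality for the deviations of an arm, on the block of counts that share the grid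
point `H`. -/
lemma IsPathLaw.measure_excess_le (hP : IsPathLaw π F T P) (hF : HeavyTailed F T) {a ζ : ℝ}
    (ha : 1 < a) (hζ : 0 < ζ) (hψ : psi (2 * ζ / a) ≥ 2 * a / ζ) {τ : ℕ} (hτ : 0 < τ) (e : ℕ)
    (k : Fin K) {ε : ℝ} (hε : ε ^ 2 = 1) {H : ℝ} (hH : 0 < H) {x : ℝ} (hx : 0 ≤ x) :
    P {ω | ∃ t ≤ T, 0 < (armSlots τ e k t ω).card ∧ gridUp a (armSlots τ e k t ω).card = H ∧
      x ≤ excess F ζ τ e k ε (gridLimit τ K H) t ω} ≤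
    ENNReal.ofReal (Real.exp (-lnPlus (τ / (K * H))) * Real.exp (-(devRate a ζ * √H * x))) := by
  set u := 2 * ζ / a with hu
  set ℓ := Real.log (1 + u) with hℓ
  set B := gridLimit τ K H with hB
  set L := lnPlus (τ / (K * H)) with hL
  have ha0 : 0 < a := by linarith
  have hu0 : 0 < u := by positivity
  have hℓ0 : 0 < ℓ := Real.log_pos (by linarith)
  have hB0 : 0 < B := gridLimit_pos τ K hH
  -- Centred saturated rewards are bounded by 2 * B, so this η makes the exponents at most ℓ = log
  -- (1 + u) in absolute value, and Bennett's variance term becomes (u - ℓ) / (4 * B ^ 2).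
  set η := ε * (ℓ / (2 * B)) with hη
  set φ := η ^ 2 * ((Real.exp ℓ - 1 - ℓ) / ℓ ^ 2) with hφ
  have hφ' : φ = (u - ℓ) / (4 * B ^ 2) := by
    rw [hφ, hη, mul_pow, hε, hℓ, Real.exp_log (by linarith), ← hℓ]
    field_simp
    ring
  have hηB : |η| * (2 * B) ≤ ℓ := by
    have h1 : |ε| = 1 := by
      rw [← sq_abs] at hε
      nlinarith [abs_nonneg ε]
    rw [hη, abs_mul, h1, abs_of_pos (by positivity)]
    field_simp
    exact le_rfl
  let inc : ℕ → Fin K × ℝ → ℝ := fun s p => if s / τ = e ∧ p.1 = k then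
    η * (sat p.2 B - ∫ y, sat y B ∂(F s k : Measure ℝ)) - φ else 0
  have hinc : ∀ t, Measurable (inc t) := fun s => by
    refine Measurable.ite ?_ ?_ measurable_const
    · exact (MeasurableSet.const _).inter (measurable_fst (measurableSet_singleton k))
    · exact ((((measurable_sat_left B).comp measurable_snd).sub_const _).const_mul _).sub_const _
  have h1 : ∀ t < T, ∀ j, ∫⁻ x, ENNReal.ofReal (Real.exp (inc t (j, x))) ∂(F t j : Measure ℝ)
      ≤ 1 := by
    intro t ht j
    by_cases h : t / τ = e ∧ j = k
    · obtain ⟨h, rfl⟩ := h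
      simp only [inc, h, and_self, if_true]
      exact lintegral_exp_sat_le_one (hF t ht j) hB0.le hℓ0 hηB
    · simp [inc, h]
  have hsum : ∀ t ω, ∑ s ∈ Finset.range t, inc s (ω s)
      = η * deviation F τ e k B t ω - φ * (armSlots τ e k t ω).card := by
    intro t ω
    simp only [inc, deviation, armSlots]
    rw [← Finset.sum_filter, Finset.sum_sub_distrib, Finset.mul_sum]
    simp [mul_comm]
  rw [← Real.exp_add, ← neg_add]
  refine le_trans (measure_mono ?_)
    (hP.measure_exists_le_sum (k, 0) hinc h1 (L + devRate a ζ * √H * x))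
  rintro ω ⟨t, ht, hn0, hnH, hxe⟩
  refine ⟨t, ht, ?_⟩
  rw [hsum]
  set n := (armSlots τ e k t ω).card
  have hn' : (0 : ℝ) < n := by exact_mod_cast hn0
  have hnle : (n : ℝ) ≤ H := hnH ▸ le_gridUp ha hn0
  have hle : H ≤ a * n := hnH ▸ gridUp_le ha hn0
  have hD : (n : ℝ) * (ζ * (1 / B) + x) ≤ ε * deviation F τ e k B t ω := by
    have hc : 1 / B ≤ confWidth τ K n :=
      inv_gridLimit_le_confWidth hτ (Fin.pos k) hn0 hnle
    have h2 : ζ * (1 / B) + x ≤ ε * deviation F τ e k B t ω / n := by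
      have h3 : x ≤ ε * deviation F τ e k B t ω / n - ζ * confWidth τ K n := hxe
      have := mul_le_mul_of_nonneg_left hc hζ.le
      linarith
    rw [le_div_iff₀ hn'] at h2
    linarith
  have := deviation_exponent ha hζ hψ hH (L := L) (one_le_lnPlus _) hB hnle hle hx hD
  rw [← hu, ← hℓ] at this
  rw [hφ', hη]
  linarith

end Deviation

/-! ### Expected underestimation and expected cost of an arm -/

section Expectations

variable {K : ℕ} {π : Policy K} {F : Environment K} {T : ℕ} {P : Measure (ℕ → Fin K × ℝ)}

/-- The largest excess of arm `k` in epoch `e` on the block of counts with grid point `H`. -/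
def maxExcess (F : Environment K) (a ζ : ℝ) (τ e : ℕ) (k : Fin K) (ε H : ℝ) (T : ℕ)
    (ω : ℕ → Fin K × ℝ) : NNReal :=
  (Finset.range T).sup fun t =>
    if 0 < (armSlots τ e k t ω).card ∧ gridUp a (armSlots τ e k t ω).card = H then
      (excess F ζ τ e k ε (gridLimit τ K H) t ω).toNNReal else 0

lemma measurable_maxExcess (F : Environment K) (a ζ : ℝ) (τ e : ℕ) (k : Fin K) (ε H : ℝ)
    (T : ℕ) : Measurable (maxExcess F a ζ τ e k ε H T) := by
  have h : maxExcess F a ζ τ e k ε H T = (Finset.range T).sup fun t ω =>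
    if 0 < (armSlots τ e k t ω).card ∧ gridUp a (armSlots τ e k t ω).card = H then
      (excess F ζ τ e k ε (gridLimit τ K H) t ω).toNNReal else 0 := by
    ext ω; simp only [maxExcess, Finset.sup_apply]
  rw [h]
  refine Finset.sup_induction (p := Measurable) measurable_const (fun f hf g hg => hf.sup hg)
    fun t _ => Measurable.ite ?_
    (measurable_excess F ζ τ _ k ε _ t).real_toNNReal measurable_const
  exact (measurable_card_armSlots τ _ k t)
    (MeasurableSet.of_discrete (s := {n : ℕ | 0 < n ∧ gridUp a n = H}))

lemma excess_le_maxExcess {a ζ : ℝ} {τ e : ℕ} {k : Fin K} {ε : ℝ} {t : ℕ} (ht : t < T)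
    {ω : ℕ → Fin K × ℝ} (hn : 0 < (armSlots τ e k t ω).card) {H : ℝ}
    (hH : gridUp a (armSlots τ e k t ω).card = H) :
    excess F ζ τ e k ε (gridLimit τ K H) t ω ≤ maxExcess F a ζ τ e k ε H T ω := by
  have := Finset.le_sup (f := fun t =>
    if 0 < (armSlots τ e k t ω).card ∧ gridUp a (armSlots τ e k t ω).card = H then
      (excess F ζ τ e k ε (gridLimit τ K H) t ω).toNNReal else 0) (Finset.mem_range.2 ht)
  simp only [hn, hH, and_self, if_true] at this
  exact (Real.le_coe_toNNReal _).trans (NNReal.coe_le_coe.2 this)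

lemma IsPathLaw.integral_maxExcess_le (hP : IsPathLaw π F T P) (hF : HeavyTailed F T) {a ζ : ℝ}
    (ha : 1 < a) (hζ : 0 < ζ) (hψ : psi (2 * ζ / a) ≥ 2 * a / ζ) {τ : ℕ} (hτ : 0 < τ) (e : ℕ)
    (k : Fin K) {ε : ℝ} (hε : ε ^ 2 = 1) {H : ℝ} (hH : 0 < H) :
    Integrable (fun ω => (maxExcess F a ζ τ e k ε H T ω : ℝ)) P ∧
    ∫ ω, (maxExcess F a ζ τ e k ε H T ω : ℝ) ∂P ≤
      Real.exp (-lnPlus (τ / (K * H))) / (devRate a ζ * √H) := by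
  have hc := devRate_pos ha hζ
  refine integrable_and_integral_le_of_exp_tail
    (measurable_maxExcess F a ζ τ e k ε H T).coe_nnreal_real (fun ω => NNReal.coe_nonneg _)
    (Real.exp_pos _).le (by positivity) fun x hx => ?_
  refine le_trans (measure_mono ?_) (hP.measure_excess_le hF ha hζ hψ hτ e k hε hH hx.le)
  intro ω hω
  simp only [Set.mem_ofPred_eq] at hω
  lift x to NNReal using hx.le
  rw [NNReal.coe_lt_coe, maxExcess, Finset.lt_sup_iff] at hω
  obtain ⟨t, ht, h⟩ := hω
  -- The default value 0 makes the supremum a positive part; it cannot exceed x.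
  split_ifs at h with hn
  · exact ⟨t, (Finset.mem_range.1 ht).le, hn.1, hn.2, (Real.lt_toNNReal_iff_coe_lt.1 h).le⟩
  · exact absurd h (not_lt.2 zero_le)

/-- The two entries of the minimum come from bounding exp (-ln₊ y) by 1 / y and by 1. In this form
the sum over the grid is a two-sided geometric sum centred where √H * δ = 1. -/
lemma exp_neg_lnPlus_div_le {τ : ℕ} (hτ : 0 < τ) (hK : 0 < K) {δ : ℝ} (hδ0 : 0 < δ)
    (hδ : δ ^ 2 = K / τ) {c H : ℝ} (hc : 0 < c) (hH : 0 < H) :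
    Real.exp (-lnPlus (τ / (K * H))) / (c * √H) ≤
      δ / c * min (√H * δ) (1 / (√H * δ)) := by
  have hτ' : (0 : ℝ) < τ := by exact_mod_cast hτ
  have hK' : (0 : ℝ) < K := by exact_mod_cast hK
  have hs : 0 < √H := Real.sqrt_pos.2 hH
  rw [div_le_iff₀ (by positivity), mul_min_of_nonneg _ _ (by positivity),
    min_mul_of_nonneg _ _ (by positivity), le_min_iff]
  constructor
  · refine (exp_neg_lnPlus_le_inv (by positivity)).trans (le_of_eq ?_)
    have : δ / c * (√H * δ) * (c * √H) = δ ^ 2 * (√H * √H) := by field_simp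
    rw [this, hδ, Real.mul_self_sqrt hH.le]
    field_simp
  · refine (exp_neg_lnPlus_le_one _).trans (le_of_eq ?_)
    field_simp

/-- The sum of the expected maximal excesses over all blocks. -/
lemma IsPathLaw.sum_integral_maxExcess_le (hP : IsPathLaw π F T P) (hF : HeavyTailed F T)
    {a ζ : ℝ} (ha : 1 < a) (hζ : 0 < ζ) (hψ : psi (2 * ζ / a) ≥ 2 * a / ζ) {τ : ℕ} (hτ : 0 < τ)
    (e : ℕ) (k : Fin K) {ε : ℝ} (hε : ε ^ 2 = 1) {δ : ℝ} (hδ0 : 0 < δ) (hδ : δ ^ 2 = K / τ)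
    (S : ℕ) :
    ∑ s ∈ Finset.range S, ∫ ω, (maxExcess F a ζ τ e k ε (a ^ (s + 1)) T ω : ℝ) ∂P ≤
      2 * (1 + √a) / (√a - 1) / devRate a ζ * δ := by
  have ha0 : 0 < a := by linarith
  have hb : 1 < √a := by rw [Real.lt_sqrt zero_le_one]; simpa using ha
  have hc := devRate_pos ha hζ
  calc _ ≤ ∑ s ∈ Finset.range S, δ / devRate a ζ *
        min (√a ^ s * (√a * δ)) (1 / (√a ^ s * (√a * δ))) := by
        refine Finset.sum_le_sum fun s _ => ?_
        refine (hP.integral_maxExcess_le hF ha hζ hψ hτ e k hε (by positivity)).2.trans ?_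
        have h := exp_neg_lnPlus_div_le hτ (Fin.pos k) hδ0 hδ hc (pow_pos ha0 (s + 1))
        have e1 : √(a ^ (s + 1)) = √a ^ s * √a := by
          rw [← pow_succ, Real.sqrt_eq_iff_mul_self_eq (by positivity) (by positivity),
            ← mul_pow, Real.mul_self_sqrt ha0.le]
        rw [e1] at h ⊢
        rwa [mul_assoc (√a ^ s) (√a) δ] at h
    _ ≤ δ / devRate a ζ * (2 * (1 + √a) / (√a - 1)) := by
        rw [← Finset.mul_sum]
        exact mul_le_mul_of_nonneg_left (sum_min_geometric_le hb (by positivity) S) (by positivity)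
    _ = _ := by ring

/-- The event that arm `k` exceeds its mean by much when it has been selected `m` times in epoch
`e`. -/
def exceedEvent (F : Environment K) (a ζ : ℝ) (τ e : ℕ) (k : Fin K) (T : ℕ) (x : ℝ) (m : ℕ) :
    Set (ℕ → Fin K × ℝ) :=
  {ω | ∃ t ≤ T, (armSlots τ e k t ω).card = m ∧
    x ≤ excess F ζ τ e k 1 (gridLimit τ K (gridUp a m)) t ω}

lemma measurableSet_exceedEvent (F : Environment K) (a ζ : ℝ) (τ e : ℕ) (k : Fin K) (T : ℕ)
    (x : ℝ) (m : ℕ) : MeasurableSet (exceedEvent F a ζ τ e k T x m) := by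
  have h : exceedEvent F a ζ τ e k T x m = ⋃ t, ⋃ (_ : t ≤ T),
      ((fun ω => (armSlots τ e k t ω).card) ⁻¹' {m} ∩
        {ω | x ≤ excess F ζ τ e k 1 (gridLimit τ K (gridUp a m)) t ω}) := by
    ext; simp [exceedEvent, and_left_comm]
  rw [h]
  exact MeasurableSet.iUnion fun t => MeasurableSet.iUnion fun _ =>
    (measurable_card_armSlots τ e k t (measurableSet_singleton m)).inter
      (measurableSet_le measurable_const (measurable_excess F ζ τ e k 1 _ t))

/-- It is applied with y proportional to √m, so the fourth power yields the summable weight 1 / m ^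
2. -/
lemma exp_neg_le_div_pow_four {y : ℝ} (hy : 0 < y) : Real.exp (-y) ≤ 24 / y ^ 4 := by
  have h := Real.pow_div_factorial_le_exp y hy.le 4
  rw [Real.exp_neg, inv_le_comm₀ (Real.exp_pos _) (by positivity), inv_div]
  simpa [Nat.factorial] using h

lemma IsPathLaw.measureReal_exceedEvent_le (hP : IsPathLaw π F T P) (hF : HeavyTailed F T)
    {a ζ : ℝ} (ha : 1 < a) (hζ : 0 < ζ) (hψ : psi (2 * ζ / a) ≥ 2 * a / ζ) {τ : ℕ} (hτ : 0 < τ)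
    (e : ℕ) (k : Fin K) {x : ℝ} (hx : 0 < x) {m : ℕ} (hm : 0 < m) :
    P.real (exceedEvent F a ζ τ e k T x m) ≤ 24 / (devRate a ζ * x) ^ 4 * ((m : ℝ) ^ 2)⁻¹ := by
  have hc := devRate_pos ha hζ
  have hm' : (0 : ℝ) < m := by exact_mod_cast hm
  refine ENNReal.toReal_le_of_le_ofReal (by positivity) ?_
  refine le_trans (measure_mono ?_) ((hP.measure_excess_le hF ha hζ hψ hτ e k (one_pow 2)
    (gridUp_pos ha m) hx.le).trans (ENNReal.ofReal_le_ofReal ?_))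
  · rintro ω ⟨t, ht, hn, h⟩
    exact ⟨t, ht, hn ▸ hm, by rw [hn], h⟩
  · calc _ ≤ 1 * Real.exp (-(devRate a ζ * √m * x)) := by
          gcongr
          · exact exp_neg_lnPlus_le_one _
          · exact le_gridUp ha hm
      _ ≤ 24 / (devRate a ζ * √m * x) ^ 4 := by
          rw [one_mul]
          exact exp_neg_le_div_pow_four (by positivity)
      _ = _ := by
          have : √(m : ℝ) ^ 4 = (m : ℝ) ^ 2 := by
            rw [show 4 = 2 * 2 from rfl, pow_mul, Real.sq_sqrt hm'.le]
          rw [mul_pow, mul_pow, mul_pow, this]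
          field_simp

/-- The number of selections after which the confidence width of an arm is small compared with its
gap `Δ`. -/
def burnIn (ζ δ Δ : ℝ) : ℕ := ⌈2 * (12 * (1 + ζ)) ^ 2 / (δ * Δ)⌉₊

/-- Since τ / (K * m) = (1 / (δ * √m)) ^ 2, the squared width is at most (1 + 1 / (δ * √m)) / m.
With D = 12 * (1 + ζ), the burn-in makes each of the two parts at most Δ ^ 2 / (2 * D ^ 2). -/
lemma confWidth_le_of_burnIn_le {τ m : ℕ} (hτ : 0 < τ) (hK : 0 < K) {ζ δ Δ : ℝ} (hζ : 0 < ζ)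
    (hδ0 : 0 < δ) (hδ : δ ^ 2 = K / τ) (hΔ : δ ≤ Δ) (hm : burnIn ζ δ Δ ≤ m) :
    (2 + 2 * ζ) * confWidth τ K m ≤ Δ / 6 := by
  have hτ' : (0 : ℝ) < τ := by exact_mod_cast hτ
  have hK' : (0 : ℝ) < K := by exact_mod_cast hK
  have hΔ0 : 0 < Δ := hδ0.trans_le hΔ
  set D := 12 * (1 + ζ) with hD
  have hD1 : 1 ≤ D := by rw [hD]; linarith
  have h1 : 2 * D ^ 2 / (δ * Δ) ≤ m := (Nat.le_ceil _).trans (by exact_mod_cast hm)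
  have hm' : (0 : ℝ) < m := lt_of_lt_of_le (by positivity) h1
  rw [div_le_iff₀ (by positivity)] at h1
  have hs : 0 < √(m : ℝ) := Real.sqrt_pos.2 hm'
  have hs2 : √(m : ℝ) ^ 2 = m := Real.sq_sqrt hm'.le
  have h2 : 2 * D ^ 2 ≤ m * Δ ^ 2 := by
    refine h1.trans ?_
    rw [sq Δ]; gcongr
  have h3 : 1 ≤ √(m : ℝ) * Δ := by
    have : (1 : ℝ) ^ 2 ≤ (√(m : ℝ) * Δ) ^ 2 := by rw [mul_pow, hs2]; nlinarith
    exact (pow_le_pow_iff_left₀ zero_le_one (by positivity) two_ne_zero).1 this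
  have hr : (τ : ℝ) / (K * m) = (1 / (δ * √m)) ^ 2 := by
    rw [div_pow, mul_pow, hs2, hδ]; field_simp
  have hl : lnPlus (τ / (K * m)) ≤ 1 + 1 / (δ * √m) := by
    refine (lnPlus_le_one_add_sqrt (by positivity)).trans ?_
    rw [hr, Real.sqrt_sq (by positivity)]
  have h4 : D ^ 2 * (1 / (δ * √m)) ≤ m * Δ ^ 2 / 2 := by
    rw [mul_one_div, div_le_iff₀ (by positivity)]
    have : 2 * D ^ 2 * 1 ≤ m * (δ * Δ) * (√m * Δ) :=
      mul_le_mul h1 h3 zero_le_one (by positivity)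
    nlinarith
  have h5 : D * confWidth τ K m ≤ Δ := by
    have e : D * confWidth τ K m = √(D ^ 2 * (lnPlus (τ / (K * m)) / m)) := by
      rw [Real.sqrt_mul (by positivity), Real.sqrt_sq (by linarith)]; rfl
    rw [e]
    refine Real.sqrt_le_iff.2 ⟨hΔ0.le, ?_⟩
    rw [mul_div_assoc', div_le_iff₀ hm']
    have := mul_le_mul_of_nonneg_left hl (sq_nonneg D)
    nlinarith
  rw [hD] at h5
  linarith

/-- An upper bound on the contribution of the selections of arm `k` in epoch `e` that are not due
to the drift or to an underestimation of the best arm. -/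
def armCost (F : Environment K) (a ζ δ Δ : ℝ) (τ e : ℕ) (k : Fin K) (T : ℕ)
    (ω : ℕ → Fin K × ℝ) : ℝ :=
  Δ + if δ < Δ then Δ * (burnIn ζ δ Δ + ∑ m ∈ Finset.Ioc (burnIn ζ δ Δ) T,
    (exceedEvent F a ζ τ e k T (Δ / 6) m).indicator (fun _ => 1) ω) else 0

lemma integrable_armCost [IsFiniteMeasure P] (F : Environment K) (a ζ δ Δ : ℝ) (τ e : ℕ)
    (k : Fin K) (T : ℕ) : Integrable (armCost F a ζ δ Δ τ e k T) P := by
  unfold armCost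
  refine (integrable_const _).add ?_
  split_ifs
  · exact ((integrable_const _).add (integrable_finsetSum _ fun m _ =>
      (integrable_const _).indicator (measurableSet_exceedEvent F a ζ τ e k T _ m))).const_mul _
  · exact integrable_const _

/-- The burn-in N costs Δ * N = O(1 / δ + Δ). The later exceedances cost Δ * Δ ^ (-4) / N, which is
O(δ / Δ ^ 3) times Δ and hence O(1 / δ) because δ < Δ. The 4 pays for the initial selection and for
the rounding in N, each at most Δ ≤ 2. -/
lemma IsPathLaw.integral_armCost_le (hP : IsPathLaw π F T P) (hF : HeavyTailed F T)
    {a ζ : ℝ} (ha : 1 < a) (hζ : 0 < ζ) (hψ : psi (2 * ζ / a) ≥ 2 * a / ζ) {τ : ℕ} (hτ : 0 < τ)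
    (e : ℕ) (k : Fin K) {δ Δ : ℝ} (hδ0 : 0 < δ) (hΔ2 : Δ ≤ 2) :
    ∫ ω, armCost F a ζ δ Δ τ e k T ω ∂P ≤
      4 + (2 * (12 * (1 + ζ)) ^ 2 + 24 * 6 ^ 4 / devRate a ζ ^ 4) / δ := by
  have := hP.isProbabilityMeasure
  have hc := devRate_pos ha hζ
  unfold armCost
  by_cases hΔ : δ < Δ
  swap
  · simp only [hΔ, if_false]
    simp only [add_zero, integral_const, probReal_univ, smul_eq_mul, one_mul]
    have : 0 ≤ (2 * (12 * (1 + ζ)) ^ 2 + 24 * 6 ^ 4 / devRate a ζ ^ 4) / δ := by positivity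
    linarith
  have hΔ0 : 0 < Δ := hδ0.trans hΔ
  set N := burnIn ζ δ Δ with hN
  set D := 12 * (1 + ζ) with hD
  have hD1 : 1 ≤ D := by rw [hD]; linarith
  have hq : 0 < 2 * D ^ 2 / (δ * Δ) := by positivity
  have hN0 : 0 < N := Nat.ceil_pos.2 hq
  have hN1 : 2 * D ^ 2 / (δ * Δ) ≤ N := Nat.le_ceil _
  have hN2 : (N : ℝ) ≤ 2 * D ^ 2 / (δ * Δ) + 1 := (Nat.ceil_lt_add_one hq.le).le
  have hind : ∀ m ∈ Finset.Ioc N T, Integrable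
      ((exceedEvent F a ζ τ e k T (Δ / 6) m).indicator fun _ => (1 : ℝ)) P := fun m _ =>
    (integrable_const _).indicator (measurableSet_exceedEvent F a ζ τ e k T _ m)
  have hi : Integrable (fun ω => ∑ m ∈ Finset.Ioc N T,
      (exceedEvent F a ζ τ e k T (Δ / 6) m).indicator (fun _ => (1 : ℝ)) ω) P :=
    integrable_finsetSum _ hind
  have hi2 : Integrable (fun ω => (N : ℝ) + ∑ m ∈ Finset.Ioc N T,
      (exceedEvent F a ζ τ e k T (Δ / 6) m).indicator (fun _ => (1 : ℝ)) ω) P :=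
    (integrable_const _).add hi
  have hsum : ∑ m ∈ Finset.Ioc N T, P.real (exceedEvent F a ζ τ e k T (Δ / 6) m)
      ≤ 24 * 6 ^ 4 / devRate a ζ ^ 4 / (δ * Δ) := by
    calc _ ≤ ∑ m ∈ Finset.Ioc N T, 24 / (devRate a ζ * (Δ / 6)) ^ 4 * ((m : ℝ) ^ 2)⁻¹ :=
          Finset.sum_le_sum fun m hm => hP.measureReal_exceedEvent_le hF ha hζ hψ hτ e k
            (by positivity) (hN0.trans (Finset.mem_Ioc.1 hm).1)
      _ ≤ 24 / (devRate a ζ * (Δ / 6)) ^ 4 * (N : ℝ)⁻¹ := by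
          rw [← Finset.mul_sum]
          refine mul_le_mul_of_nonneg_left ?_ (by positivity)
          rcases le_total N T with h | h
          · have := sum_Ioc_inv_sq_le_sub (α := ℝ) hN0.ne' h
            have h2 : (0 : ℝ) ≤ (T : ℝ)⁻¹ := by positivity
            linarith
          · rw [Finset.Ioc_eq_empty_of_le h]; simp
      _ ≤ 24 / (devRate a ζ * (Δ / 6)) ^ 4 * (2 * D ^ 2 / (δ * Δ))⁻¹ := by
          gcongr
      _ ≤ 24 / (devRate a ζ * (Δ / 6)) ^ 4 * (δ * Δ) := by
          gcongr
          rw [inv_div]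
          exact div_le_self (by positivity) (by nlinarith)
      _ = 24 * 6 ^ 4 / devRate a ζ ^ 4 * (δ / Δ ^ 3) := by field_simp
      _ ≤ 24 * 6 ^ 4 / devRate a ζ ^ 4 * (1 / (δ * Δ)) := by
          gcongr ?_ * ?_
          rw [div_le_div_iff₀ (by positivity) (by positivity)]
          have : δ * δ ≤ Δ * Δ := mul_self_le_mul_self hδ0.le hΔ.le
          nlinarith
      _ = _ := by ring
  simp only [hΔ, if_true]
  rw [integral_add (integrable_const _) (hi2.const_mul _), integral_const_mul,
    integral_add (integrable_const _) hi, integral_finsetSum _ hind]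
  simp only [integral_const, probReal_univ, smul_eq_mul, one_mul]
  have e1 : ∀ m, ∫ ω, (exceedEvent F a ζ τ e k T (Δ / 6) m).indicator (fun _ => (1 : ℝ)) ω ∂P
      = P.real (exceedEvent F a ζ τ e k T (Δ / 6) m) := fun m => by
    rw [integral_indicator_const _ (measurableSet_exceedEvent F a ζ τ e k T _ m)]; simp
  simp_rw [e1]
  have h1 : Δ * (N + ∑ m ∈ Finset.Ioc N T, P.real (exceedEvent F a ζ τ e k T (Δ / 6) m)) ≤
      Δ * (2 * D ^ 2 / (δ * Δ) + 1 + 24 * 6 ^ 4 / devRate a ζ ^ 4 / (δ * Δ)) := by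
    gcongr
  have h2 : Δ * (2 * D ^ 2 / (δ * Δ) + 1 + 24 * 6 ^ 4 / devRate a ζ ^ 4 / (δ * Δ))
      = Δ + (2 * D ^ 2 + 24 * 6 ^ 4 / devRate a ζ ^ 4) / δ := by
    field_simp
    ring
  linarith

end Expectations

section Epoch

variable {K : ℕ} {π : Policy K} {F : Environment K} {T : ℕ} {P : Measure (ℕ → Fin K × ℝ)}

/-! ### Variation within an epoch -/

/-- The variation of the mean rewards in epoch `e`, including the step to the next epoch. -/
def epochVariation (F : Environment K) (τ T e : ℕ) : ℝ :=
  ∑ t ∈ Finset.range (T - 1) with t / τ = e, ⨆ k, |mean F (t + 1) k - mean F t k|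

lemma epochVariation_nonneg (F : Environment K) (τ T e : ℕ) : 0 ≤ epochVariation F τ T e :=
  Finset.sum_nonneg fun _ _ => Real.iSup_nonneg fun _ => abs_nonneg _

lemma sum_epochVariation (F : Environment K) (τ T : ℕ) :
    ∑ e ∈ (Finset.range T).image (· / τ), epochVariation F τ T e = totalVariation F T := by
  unfold epochVariation totalVariation
  refine Finset.sum_fiberwise_of_maps_to (fun t ht => ?_) _
  rw [Finset.mem_range] at ht
  exact Finset.mem_image_of_mem _ (Finset.mem_range.2 (by omega))

/-- The steps from the start of the epoch to s telescope, and each of them starts inside the epoch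
and before T - 1. -/
lemma abs_mean_sub_le {τ e s : ℕ} (hτ : 0 < τ) (hs : s < T) (hse : s / τ = e) (k : Fin K) :
    |mean F s k - mean F (e * τ) k| ≤ epochVariation F τ T e := by
  have hle : e * τ ≤ s := hse ▸ Nat.div_mul_le_self s τ
  have h := dist_le_Ico_sum_of_dist_le (f := fun t => mean F t k) hle
    (d := fun t => ⨆ j, |mean F (t + 1) j - mean F t j|) (fun {t} _ _ => by
      rw [dist_comm, Real.dist_eq]
      exact le_ciSup (f := fun j => |mean F (t + 1) j - mean F t j|)
        (Set.finite_range _).bddAbove k)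
  rw [dist_comm, Real.dist_eq] at h
  refine h.trans (Finset.sum_le_sum_of_subset_of_nonneg (fun t ht => ?_)
    fun _ _ _ => Real.iSup_nonneg fun _ => abs_nonneg _)
  rw [Finset.mem_Ico] at ht
  rw [Finset.mem_filter, Finset.mem_range]
  refine ⟨by omega, le_antisymm ?_ ?_⟩
  · exact hse ▸ Nat.div_le_div_right ht.2.le
  · exact (Nat.le_div_iff_mul_le hτ).2 ht.1

/-! ### Upper confidence bounds along a trajectory -/

lemma sum_pulls_past (τ t : ℕ) (k : Fin K) (ω : ℕ → Fin K × ℝ) {M : Type*} [AddCommMonoid M]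
    (f : ℕ → M) :
    ∑ s ∈ pulls τ (past t ω) k, f s = ∑ s ∈ armSlots τ (t / τ) k t ω, f s := by
  unfold pulls armSlots
  rw [Finset.sum_filter, Finset.sum_filter]
  exact Fin.sum_univ_eq_sum_range (fun s => if s / τ = t / τ ∧ (ω s).1 = k then f s else 0) t

lemma card_pulls_past (τ t : ℕ) (k : Fin K) (ω : ℕ → Fin K × ℝ) :
    (pulls τ (past t ω) k).card = (armSlots τ (t / τ) k t ω).card := by
  rw [Finset.card_eq_sum_ones, Finset.card_eq_sum_ones]
  exact sum_pulls_past τ t k ω fun _ => 1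

lemma ucb_past (a ζ : ℝ) {τ t e : ℕ} (he : t / τ = e) (k : Fin K) (ω : ℕ → Fin K × ℝ) :
    ucb a ζ τ (past t ω) k =
      (∑ s ∈ armSlots τ e k t ω,
        sat (ω s).2 (gridLimit τ K (gridUp a (armSlots τ e k t ω).card))) /
          (armSlots τ e k t ω).card + (1 + ζ) * confWidth τ K (armSlots τ e k t ω).card := by
  subst he
  unfold ucb satMean
  rw [card_pulls_past, satLimit_eq, ← sum_pulls_past τ t k ω fun s =>
    sat (ω s).2 (gridLimit τ K (gridUp a (armSlots τ (t / τ) k t ω).card))]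
  rfl

/-- Each slot contributes two errors: the drift since the start of the epoch and the saturation bias
1 / B. -/
lemma abs_sum_integral_sat_div_sub_le (hF : HeavyTailed F T) {a : ℝ} (ha : 1 < a) {τ t e : ℕ}
    (hτ : 0 < τ) (ht : t < T) (k : Fin K) {ω : ℕ → Fin K × ℝ}
    (hn : 0 < (armSlots τ e k t ω).card) :
    |(∑ s ∈ armSlots τ e k t ω,
        ∫ x, sat x (gridLimit τ K (gridUp a (armSlots τ e k t ω).card)) ∂(F s k : Measure ℝ)) /
        (armSlots τ e k t ω).card - mean F (e * τ) k| ≤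
      epochVariation F τ T e + confWidth τ K (armSlots τ e k t ω).card := by
  set n := (armSlots τ e k t ω).card with hn_def
  have hn' : (0 : ℝ) < n := by exact_mod_cast hn
  set B := gridLimit τ K (gridUp a n)
  have hB : 0 < B := gridLimit_pos τ K (gridUp_pos ha n)
  have hc : 1 / B ≤ confWidth τ K n :=
    inv_gridLimit_le_confWidth hτ (Fin.pos k) hn (le_gridUp ha hn)
  have e1 : (∑ s ∈ armSlots τ e k t ω, ∫ x, sat x B ∂(F s k : Measure ℝ)) / n - mean F (e * τ) k
      = (∑ s ∈ armSlots τ e k t ω, (∫ x, sat x B ∂(F s k : Measure ℝ) - mean F (e * τ) k)) / n := by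
    rw [Finset.sum_sub_distrib, Finset.sum_const, ← hn_def, nsmul_eq_mul]
    field_simp
  rw [e1, abs_div, abs_of_pos hn', div_le_iff₀ hn', mul_comm (_ + _), ← nsmul_eq_mul]
  refine (Finset.abs_sum_le_sum_abs _ _).trans (Finset.sum_le_card_nsmul _ _ _ fun s hs => ?_)
  simp only [armSlots, Finset.mem_filter, Finset.mem_range] at hs
  have h1 := abs_integral_sat_sub_le (hF s (hs.1.trans ht) k) hB
  have h2 := abs_mean_sub_le (F := F) hτ (hs.1.trans ht) hs.2.1 k
  have h3 := abs_sub_le (∫ x, sat x B ∂(F s k : Measure ℝ)) (mean F s k) (mean F (e * τ) k)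
  have h4 : |∫ x, sat x B ∂(F s k : Measure ℝ) - mean F s k| ≤ 1 / B := h1
  linarith

lemma ucb_past_eq (F : Environment K) (a ζ : ℝ) {τ t e : ℕ} (he : t / τ = e) (k : Fin K)
    (ω : ℕ → Fin K × ℝ) :
    ucb a ζ τ (past t ω) k =
      deviation F τ e k (gridLimit τ K (gridUp a (armSlots τ e k t ω).card)) t ω /
          (armSlots τ e k t ω).card +
        (∑ s ∈ armSlots τ e k t ω,
          ∫ x, sat x (gridLimit τ K (gridUp a (armSlots τ e k t ω).card)) ∂(F s k : Measure ℝ)) /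
          (armSlots τ e k t ω).card
        + (1 + ζ) * confWidth τ K (armSlots τ e k t ω).card := by
  rw [ucb_past a ζ he, deviation, Finset.sum_sub_distrib]
  ring

/-- Of the factor 2 + 2 * ζ, one 1 + ζ is the bonus in the index; the other is the saturation bias
together with the deviation not counted in `excess`. -/
lemma ucb_past_le (hF : HeavyTailed F T) {a : ℝ} (ha : 1 < a) (ζ : ℝ) {τ t e : ℕ}
    (hτ : 0 < τ) (ht : t < T) (he : t / τ = e) (k : Fin K) {ω : ℕ → Fin K × ℝ}
    (hn : 0 < (armSlots τ e k t ω).card) :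
    ucb a ζ τ (past t ω) k ≤ mean F (e * τ) k + epochVariation F τ T e +
      (2 + 2 * ζ) * confWidth τ K (armSlots τ e k t ω).card +
      excess F ζ τ e k 1 (gridLimit τ K (gridUp a (armSlots τ e k t ω).card)) t ω := by
  have h := (abs_le.1 (abs_sum_integral_sat_div_sub_le hF ha hτ ht k hn)).2
  rw [ucb_past_eq F a ζ he, excess, one_mul]
  linarith

/-- Here the bonus cancels the saturation bias and the allowed deviation exactly, so only the drift
and the excess remain. -/
lemma le_ucb_past (hF : HeavyTailed F T) {a : ℝ} (ha : 1 < a) (ζ : ℝ) {τ t e : ℕ}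
    (hτ : 0 < τ) (ht : t < T) (he : t / τ = e) (k : Fin K) {ω : ℕ → Fin K × ℝ}
    (hn : 0 < (armSlots τ e k t ω).card) :
    mean F (e * τ) k - epochVariation F τ T e -
      excess F ζ τ e k (-1) (gridLimit τ K (gridUp a (armSlots τ e k t ω).card)) t ω ≤
    ucb a ζ τ (past t ω) k := by
  have h := (abs_le.1 (abs_sum_integral_sat_div_sub_le hF ha hτ ht k hn)).1
  rw [ucb_past_eq F a ζ he, excess, neg_one_mul, neg_div]
  linarith

/-! ### Pathwise bounds -/

/-- The total underestimation of arm `j` in epoch `e`, summed over the blocks of counts. -/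
def underestimation (F : Environment K) (a ζ : ℝ) (τ e : ℕ) (j : Fin K) (T : ℕ)
    (ω : ℕ → Fin K × ℝ) : ℝ :=
  ∑ s ∈ Finset.range (⌊Real.logb a T⌋₊ + 1), (maxExcess F a ζ τ e j (-1) (a ^ (s + 1)) T ω : ℝ)

lemma underestimation_nonneg (F : Environment K) (a ζ : ℝ) (τ e : ℕ) (j : Fin K) (T : ℕ)
    (ω : ℕ → Fin K × ℝ) : 0 ≤ underestimation F a ζ τ e j T ω :=
  Finset.sum_nonneg fun _ _ => NNReal.coe_nonneg _

lemma card_armSlots_le (τ e : ℕ) (k : Fin K) (t : ℕ) (ω : ℕ → Fin K × ℝ) :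
    (armSlots τ e k t ω).card ≤ t :=
  (Finset.card_filter_le _ _).trans (Finset.card_range t).le

/-- The current count lies in one of the blocks. The sum of the block maxima replaces their maximum
so that expectations can be bounded block by block, uniformly in time. -/
lemma excess_le_underestimation {a ζ : ℝ} (ha : 1 < a) {τ e : ℕ} {j : Fin K} {t : ℕ} (ht : t < T)
    {ω : ℕ → Fin K × ℝ} (hn : 0 < (armSlots τ e j t ω).card) :
    excess F ζ τ e j (-1) (gridLimit τ K (gridUp a (armSlots τ e j t ω).card)) t ω ≤
      underestimation F a ζ τ e j T ω := by
  obtain ⟨s, hs, h⟩ := gridUp_eq_pow ha hn ((card_armSlots_le τ e j t ω).trans ht.le)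
  rw [h]
  exact (excess_le_maxExcess ht hn h).trans (Finset.single_le_sum
    (f := fun s => (maxExcess F a ζ τ e j (-1) (a ^ (s + 1)) T ω : ℝ))
    (fun _ _ => NNReal.coe_nonneg _) hs)

/-- A selected arm has a small gap, or has been selected rarely, or is overestimated. -/
lemma gap_le_or (hF : HeavyTailed F T) {a ζ : ℝ} (ha : 1 < a) (hζ : 0 < ζ) {τ t e : ℕ}
    (hτ : 0 < τ) (ht : t < T) (he : t / τ = e) {δ : ℝ} (hδ0 : 0 < δ) (hδ : δ ^ 2 = K / τ)
    (j : Fin K) {k : Fin K} {ω : ℕ → Fin K × ℝ} (hadm : Admissible a ζ τ (past t ω) k)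
    {Δ : ℝ} (hΔ : Δ = mean F (e * τ) j - mean F (e * τ) k) :
    Δ ≤ 6 * epochVariation F τ T e + 3 * underestimation F a ζ τ e j T ω + δ ∨
    (armSlots τ e k t ω).card = 0 ∨ (δ < Δ ∧ ((armSlots τ e k t ω).card ≤ burnIn ζ δ Δ ∨
      ω ∈ exceedEvent F a ζ τ e k T (Δ / 6) (armSlots τ e k t ω).card)) := by
  have hv := epochVariation_nonneg F τ T e
  have hZ := underestimation_nonneg F a ζ τ e j T ω
  by_cases h1 : Δ ≤ 6 * epochVariation F τ T e + 3 * underestimation F a ζ τ e j T ω + δ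
  · exact Or.inl h1
  rcases hadm with h0 | ⟨hne, hmax⟩
  · refine Or.inr (Or.inl ?_)
    rw [← he, ← card_pulls_past, h0, Finset.card_empty]
  have hpos : ∀ i, 0 < (armSlots τ e i t ω).card := fun i => by
    rw [← he, ← card_pulls_past, Finset.card_pos, Finset.nonempty_iff_ne_empty]
    exact hne i
  have hδΔ : δ < Δ := by linarith
  refine Or.inr (Or.inr ⟨hδΔ, ?_⟩)
  by_cases hN : (armSlots τ e k t ω).card ≤ burnIn ζ δ Δ
  · exact Or.inl hN
  refine Or.inr ⟨t, ht.le, rfl, ?_⟩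
  have h2 := ucb_past_le hF ha ζ hτ ht he k (hpos k)
  have h3 := le_ucb_past hF ha ζ hτ ht he j (hpos j)
  have h4 := excess_le_underestimation (F := F) (ζ := ζ) ha ht (hpos j)
  have h5 := confWidth_le_of_burnIn_le hτ (Fin.pos k) hζ hδ0 hδ hδΔ.le (not_le.1 hN).le
  have h6 := hmax j
  -- Failure of the first alternative gives 2 * v + Z < Δ / 3 (v the epoch variation, Z the
  -- underestimation), and the burn-in makes the width term at most Δ / 6, so the excess is even at
  -- least Δ / 2.
  linarith

/-- The count of an arm grows strictly with each of its selections, so selections can be indexed by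
the count instead of by time. -/
lemma card_armSlots_injOn (τ e : ℕ) (k : Fin K) (ω : ℕ → Fin K × ℝ) (T : ℕ) :
    Set.InjOn (fun t => (armSlots τ e k t ω).card) (armSlots τ e k T ω) := by
  have key : ∀ s ∈ armSlots τ e k T ω, ∀ t, s < t →
      (armSlots τ e k s ω).card < (armSlots τ e k t ω).card := by
    intro s hs t hst
    simp only [armSlots, Finset.mem_filter] at hs
    refine Finset.card_lt_card (Finset.ssubset_iff_of_subset ?_ |>.2 ⟨s, ?_, ?_⟩)
    · exact Finset.filter_subset_filter _ (Finset.range_subset_range.2 hst.le)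
    · simp [armSlots, hst, hs.2]
    · simp [armSlots]
  intro s hs t ht h
  rcases lt_trichotomy s t with hlt | heq | hgt
  · exact absurd h (key s hs t hlt).ne
  · exact heq
  · exact absurd h (key t ht s hgt).ne'

open Classical in
/-- The number of slots in which arm `k` is selected while being rarely tried or overestimated. -/
lemma sum_armSlots_le_armCost {a ζ δ Δ : ℝ} (hΔ0 : 0 ≤ Δ) (τ e : ℕ) (k : Fin K)
    (ω : ℕ → Fin K × ℝ) :
    ∑ t ∈ armSlots τ e k T ω, (if (armSlots τ e k t ω).card = 0 ∨
      (δ < Δ ∧ ((armSlots τ e k t ω).card ≤ burnIn ζ δ Δ ∨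
      ω ∈ exceedEvent F a ζ τ e k T (Δ / 6) (armSlots τ e k t ω).card)) then Δ else 0) ≤
    armCost F a ζ δ Δ τ e k T ω := by
  set N := burnIn ζ δ Δ
  set E := exceedEvent F a ζ τ e k T (Δ / 6)
  -- The possible counts at a charged selection: 0, the burn-in, and the later counts at which an
  -- exceedance occurs.
  let M : Finset ℕ := {0} ∪ if δ < Δ then
    Finset.Ioc 0 N ∪ (Finset.Ioc N T).filter (fun m => ω ∈ E m) else ∅
  have hcard : ((armSlots τ e k T ω).filter fun t => (armSlots τ e k t ω).card = 0 ∨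
      (δ < Δ ∧ ((armSlots τ e k t ω).card ≤ N ∨ ω ∈ E (armSlots τ e k t ω).card))).card
      ≤ M.card := by
    refine Finset.card_le_card_of_injOn (fun t => (armSlots τ e k t ω).card) (fun t ht => ?_)
      ((card_armSlots_injOn τ e k ω T).mono (Finset.coe_subset.2 (Finset.filter_subset _ _)))
    simp only [Finset.coe_filter, Set.mem_ofPred_eq] at ht
    have htT : t < T := by
      have := ht.1
      simp only [armSlots, Finset.mem_filter, Finset.mem_range] at this
      exact this.1
    have hnT := (card_armSlots_le τ e k t ω).trans htT.le
    rcases Nat.eq_zero_or_pos (armSlots τ e k t ω).card with h0 | hpos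
    · simp [M, h0]
    · rcases ht.2 with h0 | ⟨hδ, h⟩
      · omega
      · simp only [M, hδ, if_true]
        refine Finset.mem_coe.2 (Finset.mem_union_right _ ?_)
        by_cases hN : (armSlots τ e k t ω).card ≤ N
        · exact Finset.mem_union_left _ (Finset.mem_Ioc.2 ⟨hpos, hN⟩)
        · exact Finset.mem_union_right _ (Finset.mem_filter.2
            ⟨Finset.mem_Ioc.2 ⟨not_le.1 hN, hnT⟩, h.resolve_left hN⟩)
  have hM : (M.card : ℝ) ≤ 1 + if δ < Δ then
      (N : ℝ) + ∑ m ∈ Finset.Ioc N T, (E m).indicator (fun _ => (1 : ℝ)) ω else 0 := by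
    have h1 : M.card ≤ 1 + (if δ < Δ then
      Finset.Ioc 0 N ∪ (Finset.Ioc N T).filter (fun m => ω ∈ E m) else ∅ : Finset ℕ).card :=
      (Finset.card_union_le _ _).trans (by simp)
    split_ifs at h1 ⊢ with hδ
    · have h2 : M.card ≤ 1 + (N + ((Finset.Ioc N T).filter (fun m => ω ∈ E m)).card) :=
        h1.trans (Nat.add_le_add_left ((Finset.card_union_le _ _).trans (by simp)) 1)
      have h3 : (((Finset.Ioc N T).filter (fun m => ω ∈ E m)).card : ℝ)
          = ∑ m ∈ Finset.Ioc N T, (E m).indicator (fun _ => (1 : ℝ)) ω := by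
        rw [Finset.card_filter]
        push_cast
        exact Finset.sum_congr rfl fun m _ => by simp [Set.indicator_apply]
      rw [← h3]
      exact_mod_cast h2
    · simpa using h1
  rw [← Finset.sum_filter, Finset.sum_const, nsmul_eq_mul]
  calc _ ≤ (M.card : ℝ) * Δ := by gcongr
    _ ≤ (1 + if δ < Δ then
      (N : ℝ) + ∑ m ∈ Finset.Ioc N T, (E m).indicator (fun _ => (1 : ℝ)) ω else 0) * Δ := by gcongr
    _ = _ := by
      unfold armCost
      split_ifs <;> ring

lemma card_epoch_le {τ : ℕ} (hτ : 0 < τ) (T e : ℕ) :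
    ((Finset.range T).filter fun t => t / τ = e).card ≤ τ := by
  have h : (Finset.range T).filter (fun t => t / τ = e) ⊆ Finset.Ico (e * τ) (e * τ + τ) := by
    intro t ht
    have h2 := (Finset.mem_filter.1 ht).2
    have h3 := Nat.div_add_mod t τ
    have h4 := Nat.mod_lt t hτ
    rw [h2, mul_comm] at h3
    rw [Finset.mem_Ico]
    omega
  simpa using Finset.card_le_card h

/-- Pathwise bound on the sum of the gaps of the arms selected in an epoch. -/
lemma sum_gap_le (hF : HeavyTailed F T) {a ζ : ℝ} (ha : 1 < a) (hζ : 0 < ζ) {τ e : ℕ}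
    (hτ : 0 < τ) {δ : ℝ} (hδ0 : 0 < δ) (hδ : δ ^ 2 = K / τ) {j : Fin K}
    (hj : ∀ k, mean F (e * τ) k ≤ mean F (e * τ) j) {ω : ℕ → Fin K × ℝ}
    (hadm : ∀ t < T, Admissible a ζ τ (past t ω) (ω t).1) :
    ∑ t ∈ Finset.range T with t / τ = e, (mean F (e * τ) j - mean F (e * τ) (ω t).1) ≤
      τ * (6 * epochVariation F τ T e + 3 * underestimation F a ζ τ e j T ω + δ) +
      ∑ k, armCost F a ζ δ (mean F (e * τ) j - mean F (e * τ) k) τ e k T ω := by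
  classical
  set Q := 6 * epochVariation F τ T e + 3 * underestimation F a ζ τ e j T ω + δ with hQ
  have hQ0 : 0 ≤ Q := by
    have hv := epochVariation_nonneg F τ T e
    have hZ := underestimation_nonneg F a ζ τ e j T ω
    linarith
  set Δ : Fin K → ℝ := fun k => mean F (e * τ) j - mean F (e * τ) k with hΔ
  have hΔ0 : ∀ k, 0 ≤ Δ k := fun k => sub_nonneg.2 (hj k)
  let rare : Fin K → ℕ → Prop := fun k t => (armSlots τ e k t ω).card = 0 ∨
      (δ < Δ k ∧ ((armSlots τ e k t ω).card ≤ burnIn ζ δ (Δ k) ∨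
      ω ∈ exceedEvent F a ζ τ e k T (Δ k / 6) (armSlots τ e k t ω).card))
  calc ∑ t ∈ Finset.range T with t / τ = e, Δ (ω t).1
      ≤ ∑ t ∈ Finset.range T with t / τ = e, (Q + if rare (ω t).1 t then Δ (ω t).1 else 0) := by
        refine Finset.sum_le_sum fun t ht => ?_
        rw [Finset.mem_filter, Finset.mem_range] at ht
        rcases gap_le_or hF ha hζ hτ ht.1 ht.2 hδ0 hδ j (hadm t ht.1) rfl with h | h
        · have : 0 ≤ if rare (ω t).1 t then Δ (ω t).1 else 0 := by
            split_ifs <;> [exact hΔ0 _; exact le_rfl]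
          have h' : Δ (ω t).1 ≤ Q := h
          linarith
        · have : rare (ω t).1 t := h
          rw [if_pos this]
          linarith
    _ = ((Finset.range T).filter fun t => t / τ = e).card * Q +
        ∑ t ∈ Finset.range T with t / τ = e, (if rare (ω t).1 t then Δ (ω t).1 else 0) := by
        rw [Finset.sum_add_distrib, Finset.sum_const, nsmul_eq_mul]
    _ ≤ τ * Q + ∑ k, armCost F a ζ δ (Δ k) τ e k T ω := by
        refine add_le_add ?_ ?_
        · gcongr
          exact card_epoch_le hτ T e
        · rw [← Finset.sum_fiberwise _ fun t => (ω t).1]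
          refine Finset.sum_le_sum fun k _ => ?_
          refine le_trans (le_of_eq ?_) (sum_armSlots_le_armCost (F := F) (T := T) (a := a)
            (ζ := ζ) (δ := δ) (hΔ0 k) τ e k ω)
          rw [Finset.filter_filter]
          refine Finset.sum_congr rfl fun t ht => ?_
          rw [(Finset.mem_filter.1 ht).2.2]

/-! ### The expected regret of an epoch -/

/-- The constant of the regret bound for one epoch. -/
def epochConst (a ζ : ℝ) : ℝ :=
  5 + 3 * (2 * (1 + √a) / (√a - 1) / devRate a ζ) +
    (2 * (12 * (1 + ζ)) ^ 2 + 24 * 6 ^ 4 / devRate a ζ ^ 4)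

lemma two_le_epochConst {a ζ : ℝ} (ha : 1 < a) (hζ : 0 < ζ) : 2 ≤ epochConst a ζ := by
  have hc := devRate_pos ha hζ
  have hb : 0 < √a - 1 := by
    have : 1 < √a := by rw [Real.lt_sqrt zero_le_one]; simpa using ha
    linarith
  have h1 : 0 ≤ 3 * (2 * (1 + √a) / (√a - 1) / devRate a ζ) := by positivity
  have h2 : 0 ≤ 2 * (12 * (1 + ζ)) ^ 2 + 24 * 6 ^ 4 / devRate a ζ ^ 4 := by positivity
  unfold epochConst
  linarith

lemma bestMean_sub_mean_le_two [Nonempty (Fin K)] (hF : HeavyTailed F T) {t : ℕ} (ht : t < T)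
    (k : Fin K) : bestMean F t - mean F t k ≤ 2 := by
  have h1 : bestMean F t ≤ 1 := ciSup_le fun j => (abs_le.1 (abs_mean_le_one hF ht j)).2
  have h2 := (abs_le.1 (abs_mean_le_one hF ht k)).1
  linarith

lemma integrable_sum_gap [IsFiniteMeasure P] (F : Environment K) (s : Finset ℕ) :
    Integrable (fun ω => ∑ t ∈ s, (bestMean F t - mean F t (ω t).1)) P :=
  integrable_finsetSum _ fun t _ => (integrable_const _).sub (integrable_comp_arm _ t)

/-- All gaps are frozen at the start of the epoch. This makes the comparison arm deterministic and
costs 2 * v per slot (v the epoch variation); another 6 * v comes from `gap_le_or`. -/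
lemma IsPathLaw.integral_sum_epoch_le (hP : IsPathLaw π F T P) (hF : HeavyTailed F T) {a ζ : ℝ}
    (ha : 1 < a) (hζ : 0 < ζ) (hψ : psi (2 * ζ / a) ≥ 2 * a / ζ) {τ : ℕ} (hτ : 0 < τ)
    (hK : 0 < K) (hπ : IsRRMOSS a ζ τ π) {e : ℕ} (he : e * τ < T) :
    ∫ ω, ∑ t ∈ Finset.range T with t / τ = e, (bestMean F t - mean F t (ω t).1) ∂P ≤
      epochConst a ζ * (τ * √(K / τ)) + 8 * τ * epochVariation F τ T e := by
  have := hP.isProbabilityMeasure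
  have : Nonempty (Fin K) := ⟨⟨0, hK⟩⟩
  have hτ' : (0 : ℝ) < τ := by exact_mod_cast hτ
  have hK' : (0 : ℝ) < K := by exact_mod_cast hK
  set δ := √((K : ℝ) / τ) with hδ_def
  have hδ0 : 0 < δ := Real.sqrt_pos.2 (by positivity)
  have hδ : δ ^ 2 = K / τ := Real.sq_sqrt (by positivity)
  have hv := epochVariation_nonneg F τ T e
  have hcard : (((Finset.range T).filter fun t => t / τ = e).card : ℝ) ≤ τ := by
    exact_mod_cast card_epoch_le hτ T e
  rcases le_or_gt K τ with hKτ | hKτ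
  · obtain ⟨j, hj⟩ := Finite.exists_max (mean F (e * τ))
    set Z := underestimation F a ζ τ e j T with hZ
    set Δ : Fin K → ℝ := fun k => mean F (e * τ) j - mean F (e * τ) k with hΔ
    have hpath : ∀ᵐ ω ∂P, ∑ t ∈ Finset.range T with t / τ = e, (bestMean F t - mean F t (ω t).1)
        ≤ 8 * τ * epochVariation F τ T e + τ * δ + (3 * τ) * Z ω
          + ∑ k, armCost F a ζ δ (Δ k) τ e k T ω := by
      filter_upwards [hP.ae_admissible hπ] with ω hω
      have h1 := sum_gap_le hF ha hζ hτ hδ0 hδ hj hω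
      have h2 : ∑ t ∈ Finset.range T with t / τ = e, (bestMean F t - mean F t (ω t).1) ≤
          ∑ t ∈ Finset.range T with t / τ = e, (2 * epochVariation F τ T e +
            (mean F (e * τ) j - mean F (e * τ) (ω t).1)) := by
        refine Finset.sum_le_sum fun t ht => ?_
        rw [Finset.mem_filter, Finset.mem_range] at ht
        have h3 : bestMean F t ≤ mean F (e * τ) j + epochVariation F τ T e :=
          ciSup_le fun i => by
            have := (abs_le.1 (abs_mean_sub_le (F := F) hτ ht.1 ht.2 i)).2
            linarith [hj i]
        have h4 := (abs_le.1 (abs_mean_sub_le (F := F) hτ ht.1 ht.2 (ω t).1)).1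
        linarith
      rw [Finset.sum_add_distrib, Finset.sum_const, nsmul_eq_mul] at h2
      have h5 : (((Finset.range T).filter fun t => t / τ = e).card : ℝ) *
          (2 * epochVariation F τ T e) ≤ τ * (2 * epochVariation F τ T e) := by gcongr
      linarith
    have hZi : ∀ s ∈ Finset.range (⌊Real.logb a T⌋₊ + 1), Integrable
        (fun ω => (maxExcess F a ζ τ e j (-1) (a ^ (s + 1)) T ω : ℝ)) P := fun s _ =>
      (hP.integral_maxExcess_le hF ha hζ hψ hτ e j (by norm_num) (by positivity)).1
    have hZint : Integrable Z P := integrable_finsetSum _ hZi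
    have hZle : ∫ ω, Z ω ∂P ≤ 2 * (1 + √a) / (√a - 1) / devRate a ζ * δ := by
      simp only [hZ, underestimation]
      rw [integral_finsetSum _ hZi]
      exact hP.sum_integral_maxExcess_le hF ha hζ hψ hτ e j (by norm_num) hδ0 hδ _
    have hAint : ∀ k ∈ Finset.univ, Integrable (armCost F a ζ δ (Δ k) τ e k T) P := fun k _ =>
      integrable_armCost F a ζ δ (Δ k) τ e k T
    set A := 2 * (12 * (1 + ζ)) ^ 2 + 24 * 6 ^ 4 / devRate a ζ ^ 4 with hA
    have hAle : ∑ k, ∫ ω, armCost F a ζ δ (Δ k) τ e k T ω ∂P ≤ K * (4 + A / δ) := by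
      have : ∑ k : Fin K, ∫ ω, armCost F a ζ δ (Δ k) τ e k T ω ∂P ≤ ∑ _k : Fin K, (4 + A / δ) := by
        refine Finset.sum_le_sum fun k _ => hP.integral_armCost_le hF ha hζ hψ hτ e k hδ0 ?_
        have h1 := (abs_le.1 (abs_mean_le_one hF he j)).2
        have h2 := (abs_le.1 (abs_mean_le_one hF he k)).1
        simp only [hΔ]
        linarith
      simpa [mul_add] using this
    have hi1 : Integrable (fun ω => 8 * τ * epochVariation F τ T e + τ * δ + (3 * τ) * Z ω) P :=
      (integrable_const _).add (hZint.const_mul _)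
    have hi2 : Integrable (fun ω => ∑ k, armCost F a ζ δ (Δ k) τ e k T ω) P :=
      integrable_finsetSum _ hAint
    have hKδ : (K : ℝ) / δ = τ * δ := by
      rw [div_eq_iff hδ0.ne', mul_assoc, ← sq, hδ]; field_simp
    -- Only here is K ≤ τ needed: it pays for the initial selections of all arms.
    have hKle : (K : ℝ) ≤ τ * δ := by
      rw [← hKδ, le_div_iff₀ hδ0]
      refine mul_le_of_le_one_right hK'.le ?_
      rw [hδ_def, Real.sqrt_le_one, div_le_one hτ']
      exact_mod_cast hKτ
    calc _ ≤ ∫ ω, (8 * τ * epochVariation F τ T e + τ * δ + (3 * τ) * Z ω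
          + ∑ k, armCost F a ζ δ (Δ k) τ e k T ω) ∂P :=
          integral_mono_ae (integrable_sum_gap F _) (hi1.add hi2) hpath
      _ = 8 * τ * epochVariation F τ T e + τ * δ + (3 * τ) * ∫ ω, Z ω ∂P
          + ∑ k, ∫ ω, armCost F a ζ δ (Δ k) τ e k T ω ∂P := by
          rw [integral_add hi1 hi2, integral_add (integrable_const _) (hZint.const_mul _),
            integral_const_mul, integral_finsetSum _ hAint]
          simp
      _ ≤ 8 * τ * epochVariation F τ T e + τ * δ +
          (3 * τ) * (2 * (1 + √a) / (√a - 1) / devRate a ζ * δ) + K * (4 + A / δ) := by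
          gcongr
      _ = 8 * τ * epochVariation F τ T e + τ * δ +
          3 * (2 * (1 + √a) / (√a - 1) / devRate a ζ) * (τ * δ) + (4 * K + A * (K / δ)) := by
          ring
      _ ≤ 8 * τ * epochVariation F τ T e + τ * δ +
          3 * (2 * (1 + √a) / (√a - 1) / devRate a ζ) * (τ * δ) +
          (4 * (τ * δ) + A * (τ * δ)) := by
          rw [hKδ]; gcongr
      _ = _ := by
          unfold epochConst
          rw [← hA]
          ring
  -- With more arms than slots, δ ≥ 1 and the trivial regret 2 * τ suffices.
  · have h1 : ∫ ω, ∑ t ∈ Finset.range T with t / τ = e, (bestMean F t - mean F t (ω t).1) ∂P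
        ≤ ∫ _, (τ * 2 : ℝ) ∂P := by
      refine integral_mono (integrable_sum_gap F _) (integrable_const _) fun ω => ?_
      refine (Finset.sum_le_card_nsmul _ _ 2 fun t ht =>
        bestMean_sub_mean_le_two hF (Finset.mem_range.1 (Finset.mem_filter.1 ht).1) _).trans ?_
      rw [nsmul_eq_mul]
      gcongr
    have h2 : 1 ≤ δ := by
      rw [hδ_def, Real.one_le_sqrt, one_le_div hτ']
      exact_mod_cast hKτ.le
    have h3 : 2 * (τ * 1) ≤ epochConst a ζ * (τ * δ) := by
      have := two_le_epochConst ha hζ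
      gcongr
    simp only [integral_const, probReal_univ, smul_eq_mul, one_mul] at h1
    have h4 : 0 ≤ 8 * τ * epochVariation F τ T e := by positivity
    linarith

/-! ### The regret over the horizon -/

lemma regret_le_two_mul (hF : HeavyTailed F T) (hK : 0 < K) : regret π F T ≤ 2 * T := by
  have hP := isPathLaw_map_extend π F T (⟨0, hK⟩, 0)
  have := hP.isProbabilityMeasure
  have : Nonempty (Fin K) := ⟨⟨0, hK⟩⟩
  rw [hP.regret_eq hF]
  calc _ ≤ ∫ _, (2 * T : ℝ) ∂((historyLaw π F T).map (extend (⟨0, hK⟩, 0))) := by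
        refine integral_mono (integrable_sum_gap F _) (integrable_const _) fun ω => ?_
        refine (Finset.sum_le_card_nsmul _ _ 2 fun t ht =>
          bestMean_sub_mean_le_two hF (Finset.mem_range.1 ht) _).trans (le_of_eq ?_)
        simp [mul_comm]
    _ = 2 * T := by simp

/-- The regret of Resetting Robust MOSS with an arbitrary period. -/
lemma regret_le_of_isRRMOSS {V : ℝ} (hF : F ∈ envClass V T K) {a ζ : ℝ}
    (ha : 1 < a) (hζ : 0 < ζ) (hψ : psi (2 * ζ / a) ≥ 2 * a / ζ) {τ : ℕ} (hτ : 0 < τ)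
    (hτT : τ ≤ T) (hK : 0 < K) (hπ : IsRRMOSS a ζ τ π) :
    regret π F T ≤ 2 * epochConst a ζ * (T * √(K / τ)) + 8 * τ * V := by
  obtain ⟨hF, hV⟩ := hF
  have hP := isPathLaw_map_extend π F T (⟨0, hK⟩, 0)
  set P := (historyLaw π F T).map (extend (⟨0, hK⟩, 0))
  have := hP.isProbabilityMeasure
  have hτ' : (0 : ℝ) < τ := by exact_mod_cast hτ
  have hC := two_le_epochConst ha hζ
  set I := (Finset.range T).image (· / τ) with hI
  -- The last epoch may be incomplete; τ ≤ T absorbs it into the factor 2.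
  have hcard : (I.card : ℝ) * τ ≤ 2 * T := by
    have h1 : I.card ≤ T / τ + 1 := by
      have : I ⊆ Finset.range (T / τ + 1) := by
        intro e he
        obtain ⟨t, ht, rfl⟩ := Finset.mem_image.1 he
        rw [Finset.mem_range, Nat.lt_succ_iff]
        exact Nat.div_le_div_right (Finset.mem_range.1 ht).le
      simpa using Finset.card_le_card this
    have h2 : I.card * τ ≤ 2 * T := by
      calc I.card * τ ≤ (T / τ + 1) * τ := by gcongr
        _ = T / τ * τ + τ := by ring
        _ ≤ T + T := add_le_add (Nat.div_mul_le_self T τ) hτT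
        _ = 2 * T := by ring
    exact_mod_cast h2
  have hsplit : ∀ ω : ℕ → Fin K × ℝ, ∑ t ∈ Finset.range T, (bestMean F t - mean F t (ω t).1)
      = ∑ e ∈ I, ∑ t ∈ Finset.range T with t / τ = e, (bestMean F t - mean F t (ω t).1) :=
    fun ω => (Finset.sum_fiberwise_of_maps_to (fun t ht => Finset.mem_image_of_mem _ ht) _).symm
  rw [hP.regret_eq hF]
  simp_rw [hsplit]
  rw [integral_finsetSum _ fun e _ => integrable_sum_gap F _]
  calc _ ≤ ∑ e ∈ I, (epochConst a ζ * (τ * √(K / τ)) + 8 * τ * epochVariation F τ T e) := by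
        refine Finset.sum_le_sum fun e he => ?_
        obtain ⟨t, ht, rfl⟩ := Finset.mem_image.1 he
        exact hP.integral_sum_epoch_le hF ha hζ hψ hτ hK hπ
          ((Nat.div_mul_le_self t τ).trans_lt (Finset.mem_range.1 ht))
    _ = (I.card * τ) * (epochConst a ζ * √(K / τ)) + 8 * τ * totalVariation F T := by
        rw [Finset.sum_add_distrib, Finset.sum_const, nsmul_eq_mul, ← Finset.mul_sum,
          sum_epochVariation]
        ring
    _ ≤ (2 * T) * (epochConst a ζ * √(K / τ)) + 8 * τ * V := by
        have : 0 ≤ epochConst a ζ := by linarith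
        gcongr
    _ = _ := by ring

end Epoch

end NonstationaryBandit

end

/-! ### Choice of the period and the final bound -/

open NonstationaryBandit in
theorem theorem4 (a ζ : ℝ) (ha : 1 < a) (hζ : 0 < ζ)
    (hψ : NonstationaryBandit.psi (2 * ζ / a) ≥ 2 * a / ζ) :
    ∃ C : ℝ, 0 < C ∧ ∀ (K T : ℕ) (V : ℝ), 1 ≤ K → 1 ≤ T → 0 < V →
      NonstationaryBandit.resetPeriod K T V ≤ T →
        ∀ π : NonstationaryBandit.Policy K,
          NonstationaryBandit.IsRRMOSS a ζ (NonstationaryBandit.resetPeriod K T V) π →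
            NonstationaryBandit.worstCaseRegret π V T ≤
              ((C * ((K : ℝ) * V) ^ (1 / 3 : ℝ) * (T : ℝ) ^ (2 / 3 : ℝ) : ℝ) : EReal) := by
  have hC := two_le_epochConst ha hζ
  refine ⟨2 * epochConst a ζ + 16, by linarith, ?_⟩
  intro K T V hK hT hV hτT π hπ
  refine iSup₂_le fun F hF => EReal.coe_le_coe_iff.2 ?_
  have hK1 : (1 : ℝ) ≤ K := by exact_mod_cast hK
  have hK' : (0 : ℝ) < K := by linarith
  have hT' : (0 : ℝ) < T := by exact_mod_cast hT
  set τ₀ : ℝ := (K : ℝ) ^ (1 / 3 : ℝ) * ((T : ℝ) / V) ^ (2 / 3 : ℝ) with hτ₀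
  set τ := resetPeriod K T V with hτ_def
  set G : ℝ := ((K : ℝ) * V) ^ (1 / 3 : ℝ) * (T : ℝ) ^ (2 / 3 : ℝ) with hG
  have hτ₀0 : 0 < τ₀ := by positivity
  have hG0 : 0 < G := by positivity
  have hτ : 0 < τ := Nat.ceil_pos.2 hτ₀0
  have hτ' : (0 : ℝ) < τ := by exact_mod_cast hτ
  have hτge : τ₀ ≤ τ := Nat.le_ceil _
  have hτlt : (τ : ℝ) < τ₀ + 1 := Nat.ceil_lt_add_one hτ₀0.le
  -- Cube roots of K, T and V as variables turn the identities between real powers into polynomial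
  -- ones.
  have cube : ∀ x : ℝ, 0 < x → ∃ y, 0 < y ∧ x ^ (1 / 3 : ℝ) = y ∧ x ^ (2 / 3 : ℝ) = y ^ 2 ∧
      x = y ^ 3 := fun x hx => by
    refine ⟨x ^ (1 / 3 : ℝ), by positivity, rfl, ?_, ?_⟩
    · rw [← Real.rpow_natCast, ← Real.rpow_mul hx.le]; norm_num
    · rw [← Real.rpow_natCast, ← Real.rpow_mul hx.le]; norm_num
  obtain ⟨κ, hκ, hκ1, -, hκ3⟩ := cube K hK'
  obtain ⟨y, hy, -, hy2, hy3⟩ := cube T hT'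
  obtain ⟨w, hw, hw1, hw2, hw3⟩ := cube V hV
  have hτ₀e : τ₀ = κ * (y ^ 2 / w ^ 2) := by
    rw [hτ₀, Real.div_rpow hT'.le hV.le, hκ1, hy2, hw2]
  have hGe : G = κ * w * y ^ 2 := by
    rw [hG, Real.mul_rpow hK'.le hV.le, hκ1, hy2, hw1]
  have hτV : τ₀ * V = G := by rw [hτ₀e, hGe, hw3]; field_simp
  have hTK : (T : ℝ) ^ 2 * K = G ^ 2 * τ₀ := by rw [hτ₀e, hGe, hκ3, hy3]; field_simp
  have goal_eq : (2 * epochConst a ζ + 16) * ((K : ℝ) * V) ^ (1 / 3 : ℝ) * (T : ℝ) ^ (2 / 3 : ℝ)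
      = (2 * epochConst a ζ + 16) * G := by rw [hG, mul_assoc]
  rw [goal_eq]
  -- For τ₀ < 1 rounding up may enlarge the period by an unbounded factor, but then T ≤ G and the
  -- trivial bound 2 * T is enough. Otherwise τ ≤ 2 * τ₀, so the drift term is at most 16 * G.
  rcases lt_or_ge τ₀ 1 with h1 | h1
  · have hTG : (T : ℝ) ≤ G := by
      refine (pow_le_pow_iff_left₀ hT'.le hG0.le two_ne_zero).1 ?_
      calc (T : ℝ) ^ 2 ≤ T ^ 2 * K := le_mul_of_one_le_right (by positivity) hK1
        _ = G ^ 2 * τ₀ := hTK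
        _ ≤ G ^ 2 := mul_le_of_le_one_right (by positivity) h1.le
    have := regret_le_two_mul (π := π) hF.1 hK
    nlinarith
  · have hTG : (T : ℝ) * √(K / τ) ≤ G := by
      refine (pow_le_pow_iff_left₀ (by positivity) hG0.le two_ne_zero).1 ?_
      rw [mul_pow, Real.sq_sqrt (by positivity), mul_div_assoc', hTK, div_le_iff₀ hτ']
      gcongr
    have hτV2 : τ * V ≤ 2 * G := by
      rw [← hτV]
      nlinarith
    have := regret_le_of_isRRMOSS hF ha hζ hψ hτ hτT hK hπ
    nlinarith
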